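/- Let $n,m\ge 0$ be integers, let $f:\mathbb{R}^n\to\mathbb{R}$ be strictly concave and $g=(g_1,\dots,g_m):\mathbb{R}^n\to\mathbb{R}^m$ have convex components, both continuously differentiable with locally Lipschitz gradients $\nabla f,\nabla g_1,\dots,\nabla g_m$. Consider the problem of maximizing $f(x)$ subject to $g(x)\le 0$ (componentwise). Assume that Slater's condition holds, i.e. there is $x\in\mathbb{R}^n$ with $g_i(x)<0$ for all $i$, and that the problem has an optimizer, i.e. a feasible point at which $f$ attains its maximum over the feasible set. Let $L(x,\lambda)=f(x)-\lambda^\top g(x)$. A pair $(x_*,\lambda_*)\in\mathbb{R}^n\times\mathbb{R}^m_{\ge 0}$ is called a primal-dual optimizer if $x_*$ is an optimizer of the problem and $\lambda_*$ minimizes $q(\lambda)=\sup_{x\in\mathbb{R}^n}L(x,\lambda)\in(-\infty,+\infty]$ over $\lambda\in\mathbb{R}^m_{\ge0}$. For $a\in\mathbb{R}$ and $b\ge 0$ put $[a]_b^+=a$ if $b>0$ and $[a]_b^+=\max\{0,a\}$ if $b=0$. The primal-dual dynamics on $\mathbb{R}^n\times\mathbb{R}^m_{\ge0}$ is $$\dot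 x=\nabla f(x)-\sum_{i=1}^m\lambda_i\nabla g_i(x),\qquad \dot\lambda_i=[g_i(x)]_{\lambda_i}^+\quad(i=1,\dots,m).$$ A (Carathéodory) solution on $[0,T)$, $0<T\le\infty$, is a curve $\gamma:[0,T)\to\mathbb{R}^n\times\mathbb{R}^m_{\ge0}$ that is absolutely continuous on compact subintervals of $[0,T)$ and satisfies these equations almost everywhere on $[0,T)$. Then the set $S$ of primal-dual optimizers coincides with the set of saddle points of $L$ on $\mathbb{R}^n\times\mathbb{R}^m_{\ge0}$, i.e. of the $(x_*,\lambda_*)\in\mathbb{R}^n\times\mathbb{R}^m_{\ge0}$ with $L(x,\lambda_*)\le L(x_*,\lambda_*)\le L(x_*,\lambda)$ for all $x\in\mathbb{R}^n$, $\lambda\in\mathbb{R}^m_{\ge0}$, and $S$ is globally asymptotically stable on $\mathbb{R}^n\times\mathbb{R}^m_{\ge 0}$ under the primal-dual dynamics, that is: 1. from every point of $\mathbb{R}^n\times\mathbb{R}^m_{\ge0}$ there starts a solution on $[0,\infty)$, and every solution on an interval $[0,T)$ is the restriction of a solution on $[0,\infty)$; 2. for every $\varepsilon>0$ there is $\delta>0$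 such that every solution with initial point at Euclidean distance less than $\delta$ from $S$ stays at distance less than $\varepsilon$ from $S$ as long as it is defined; 3. the distance to $S$ tends to $0$ as $t\to\infty$ along every solution on $[0,\infty)$. Moreover, every solution on $[0,\infty)$ converges, as $t\to\infty$, to a single point of $S$. -/

import Mathlib

open Set Filter Topology MeasureTheory

noncomputable section

namespace PrimalDual

/-! ### Carathéodory solutions and stability of sets -/

section Dynamics

variable {E : Type*} [NormedAddCommGroup E] [NormedSpace ℝ E]

/-- `γ` is a Carathéodory solution on `[0, T)`, `0 < T ≤ ∞`, of `γ' = X(γ)`, where the vector field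
is defined on the domain `K`: the curve takes its values in `K`, it is absolutely continuous
on every compact subinterval `[0, b]` of `[0, T)`, and it satisfies the differential equation
almost everywhere on `[0, T)`. Values of `X` outside `K`, and of `γ` outside `[0, T)`,
play no role. -/
structure IsCaratheodorySolution (K : Set E) (X : E → E) (T : EReal) (γ : ℝ → E) : Prop where
  pos : 0 < T
  mem : ∀ t : ℝ, 0 ≤ t → (t : EReal) < T → γ t ∈ K
  absCont : ∀ b : ℝ, 0 ≤ b → (b : EReal) < T → AbsolutelyContinuousOnInterval γ 0 b
  ode : ∀ᵐ t : ℝ, 0 ≤ t → (t : EReal) < T → HasDerivAt γ (X (γ t)) t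

/-- The set `S` is globally asymptotically stable on `K` under `γ' = X(γ)`: solutions exist for all
times from every initial point of `K`, every solution can be continued for all times,
`S` is Lyapunov stable, and every solution approaches `S`. -/
structure IsGloballyAsymptoticallyStableOn (K : Set E) (X : E → E) (S : Set E) : Prop where
  subset : S ⊆ K
  exists_solution : ∀ z ∈ K, ∃ γ : ℝ → E, IsCaratheodorySolution K X ⊤ γ ∧ γ 0 = z
  extends_solution : ∀ (T : EReal) (γ : ℝ → E), IsCaratheodorySolution K X T γ →
    ∃ γ' : ℝ → E, IsCaratheodorySolution K X ⊤ γ' ∧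
      ∀ t : ℝ, 0 ≤ t → (t : EReal) < T → γ' t = γ t
  stable : ∀ ε > 0, ∃ δ > 0, ∀ (T : EReal) (γ : ℝ → E), IsCaratheodorySolution K X T γ →
    γ 0 ∈ Metric.thickening δ S →
      ∀ t : ℝ, 0 ≤ t → (t : EReal) < T → γ t ∈ Metric.thickening ε S
  attractive : ∀ γ : ℝ → E, IsCaratheodorySolution K X ⊤ γ →
    ∀ ε > 0, ∀ᶠ t in atTop, γ t ∈ Metric.thickening ε S

end Dynamics

/-! ### The optimization problem `max f(x)` subject to `g(x) ≤ 0` -/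

section Problem

variable {n m : ℕ}

/-- The space `ℝⁿ × ℝᵐ` with the 2-norm. -/
abbrev State (n m : ℕ) : Type :=
  WithLp 2 (EuclideanSpace ℝ (Fin n) × EuclideanSpace ℝ (Fin m))

/-- The Lagrangian `L(x, λ) = f(x) - λᵀ g(x)`. -/
def lagrangian (f : EuclideanSpace ℝ (Fin n) → ℝ)
    (g : EuclideanSpace ℝ (Fin n) → EuclideanSpace ℝ (Fin m))
    (x : EuclideanSpace ℝ (Fin n)) (lam : EuclideanSpace ℝ (Fin m)) : ℝ :=
  f x - ∑ i, lam i * g x i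

/-- `x` solves the primal problem: it is feasible and maximizes `f` among the feasible points. -/
def IsPrimalOptimizer (f : EuclideanSpace ℝ (Fin n) → ℝ)
    (g : EuclideanSpace ℝ (Fin n) → EuclideanSpace ℝ (Fin m))
    (x : EuclideanSpace ℝ (Fin n)) : Prop :=
  (∀ i, g x i ≤ 0) ∧ ∀ y, (∀ i, g y i ≤ 0) → f y ≤ f x

/-- The dual function `q(λ) = sup_x L(x, λ)`, possibly `+∞`. -/
def dualFunction (f : EuclideanSpace ℝ (Fin n) → ℝ)
    (g : EuclideanSpace ℝ (Fin n) → EuclideanSpace ℝ (Fin m))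
    (lam : EuclideanSpace ℝ (Fin m)) : EReal :=
  ⨆ x : EuclideanSpace ℝ (Fin n), (lagrangian f g x lam : EReal)

/-- `λ` solves the dual problem: it minimizes the dual function over `λ ≥ 0`. -/
def IsDualOptimizer (f : EuclideanSpace ℝ (Fin n) → ℝ)
    (g : EuclideanSpace ℝ (Fin n) → EuclideanSpace ℝ (Fin m))
    (lam : EuclideanSpace ℝ (Fin m)) : Prop :=
  (∀ i, 0 ≤ lam i) ∧ ∀ mu : EuclideanSpace ℝ (Fin m), (∀ i, 0 ≤ mu i) →
    dualFunction f g lam ≤ dualFunction f g mu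

/-- The set of primal-dual optimizers. -/
def primalDualOptimizers (f : EuclideanSpace ℝ (Fin n) → ℝ)
    (g : EuclideanSpace ℝ (Fin n) → EuclideanSpace ℝ (Fin m)) : Set (State n m) :=
  {z | IsPrimalOptimizer f g z.fst ∧ IsDualOptimizer f g z.snd}

variable (n m) in
/-- The domain `ℝⁿ × ℝᵐ_{≥0}`. -/
def domain : Set (State n m) := {z | ∀ i, 0 ≤ z.snd i}

/-- The set of saddle points of the Lagrangian over `ℝⁿ × ℝᵐ_{≥0}`. -/
def saddlePoints (f : EuclideanSpace ℝ (Fin n) → ℝ)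
    (g : EuclideanSpace ℝ (Fin n) → EuclideanSpace ℝ (Fin m)) : Set (State n m) :=
  {z | z ∈ domain n m ∧
    (∀ x, lagrangian f g x z.snd ≤ lagrangian f g z.fst z.snd) ∧
    ∀ lam : EuclideanSpace ℝ (Fin m), (∀ i, 0 ≤ lam i) →
      lagrangian f g z.fst z.snd ≤ lagrangian f g z.fst lam}

/-- The operator `[a]_b^+`, used for `b ≥ 0` only: it is `a` if `b > 0` and `max {0, a}`
if `b = 0`. -/
def plusProj (a b : ℝ) : ℝ := if 0 < b then a else max 0 a

/-- The primal-dual dynamics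
`x' = ∇f(x) - ∑ᵢ λᵢ ∇gᵢ(x)`, `λ' = [g(x)]_λ^+`, considered on `ℝⁿ × ℝᵐ_{≥0}`. -/
def primalDualField (f : EuclideanSpace ℝ (Fin n) → ℝ)
    (g : EuclideanSpace ℝ (Fin n) → EuclideanSpace ℝ (Fin m)) (z : State n m) : State n m :=
  WithLp.toLp 2
    (gradient f z.fst - ∑ i, z.snd i • gradient (fun y => g y i) z.fst,
      WithLp.toLp 2 fun i => plusProj (g z.fst i) (z.snd i))

end Problem

end PrimalDual

end

/-! Duality: Slater's condition makes the separating hyperplane at the optimal value non-vertical,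
so a multiplier exists (`IsPrimalOptimizer.exists_multiplier`). With weak duality this identifies
primal-dual optimizers with saddle points.

Stability: fix a saddle point `w`. Concavity in `x` and linearity in `λ` bound the derivative of `‖z
- w‖² / 2` along the unprojected field by minus the gap `L(w.x, λ) - L(x, w.λ) ≥ 0`. Projection only
helps: it discards a negative velocity at `λᵢ = 0`, which would point away from `w`
(`inner_sub_projectVelocity_le`). Hence the distance to every saddle point is nonincreasing, which
is Lyapunov stability with `δ = ε`.

Convergence: the field is discontinuous, and Barbalat's lemma, used twice, takes the place of an
invariance principle. The gap is integrable in time, so it tends to `0`, and strict concavity forces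
`x → w.x`. The velocity of `x` is unprojected, hence continuous in the state; as `x` converges, this
velocity tends to `0`. A cluster point is therefore stationary in `x` with zero gap, so it is a
saddle point. Distances to it do not increase, so the whole curve converges to it.

Existence: reflecting each multiplier by the Skorokhod map turns the projected equation into `u' =
A(reflectedPath u)`, a causal Lipschitz equation solved by a contraction in an exponentially
weighted norm. The energy estimate keeps the solution in a ball on which `A` is the true field.
Uniqueness follows from a one-sided Lipschitz bound and yields the continuation of local solutions.
-/

/-! ### Calculus of absolutely continuous curves, and Barbalat's lemma. -/

section AbsoluteContinuity

/-- The composition of an absolutely continuous curve with a locally Lipschitz function is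
absolutely continuous. -/
theorem LocallyLipschitz.comp_absolutelyContinuousOnInterval {E F : Type*}
    [NormedAddCommGroup E] [PseudoMetricSpace F]
    {φ : E → F} (hφ : LocallyLipschitz φ) {γ : ℝ → E} {a b : ℝ}
    (hγ : AbsolutelyContinuousOnInterval γ a b) :
    AbsolutelyContinuousOnInterval (fun t => φ (γ t)) a b := by
  have hcpt : IsCompact (γ '' uIcc a b) := isCompact_uIcc.image_of_continuousOn hγ.continuousOn
  have hloc : LocallyLipschitzOn (γ '' uIcc a b) φ := hφ.locallyLipschitzOn
  obtain ⟨K, hK⟩ := hloc.exists_lipschitzOnWith_of_compact hcpt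
  refine (absolutelyContinuousOnInterval_iff _ _ _).2 fun ε hε => ?_
  -- `K + 1` instead of `K`, since `K` may be zero.
  obtain ⟨δ, hδ, h⟩ := (absolutelyContinuousOnInterval_iff _ _ _).1 hγ (ε / (K + 1))
    (by positivity)
  refine ⟨δ, hδ, fun E hE hEδ => ?_⟩
  have h1 := h E hE hEδ
  have h2 : ∑ i ∈ Finset.range E.1, dist (φ (γ (E.2 i).1)) (φ (γ (E.2 i).2)) ≤
      ∑ i ∈ Finset.range E.1, (K + 1 : ℝ) * dist (γ (E.2 i).1) (γ (E.2 i).2) := by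
    refine Finset.sum_le_sum fun i hi => ?_
    have hm := hE.1 i hi
    have := hK.dist_le_mul _ (mem_image_of_mem γ hm.1) _ (mem_image_of_mem γ hm.2)
    nlinarith [dist_nonneg (x := γ (E.2 i).1) (y := γ (E.2 i).2)]
  rw [← Finset.mul_sum] at h2
  refine h2.trans_lt ?_
  rw [lt_div_iff₀ (by positivity)] at h1
  linarith

/-- The increment of an absolutely continuous function is at most the integral of any upper bound
for its derivative. -/
theorem AbsolutelyContinuousOnInterval.sub_le_integral {h φ : ℝ → ℝ} {a b : ℝ} (hab : a ≤ b)
    (hh : AbsolutelyContinuousOnInterval h a b) (hφ : IntervalIntegrable φ volume a b)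
    (hd : ∀ᵐ t : ℝ, t ∈ Ioo a b → ∃ d, HasDerivAt h d t ∧ d ≤ φ t) :
    h b - h a ≤ ∫ t in a..b, φ t := by
  rw [← hh.integral_deriv_eq_sub]
  refine intervalIntegral.integral_mono_ae_restrict hab hh.intervalIntegrable_deriv hφ ?_
  rw [EventuallyLE, ← restrict_Ioo_eq_restrict_Icc, ae_restrict_iff' measurableSet_Ioo]
  filter_upwards [hd] with t ht hmem
  obtain ⟨d, hd, hle⟩ := ht hmem
  rwa [hd.deriv]

theorem AbsolutelyContinuousOnInterval.le_of_hasDerivAt_nonpos {h : ℝ → ℝ} {a b : ℝ} (hab : a ≤ b)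
    (hh : AbsolutelyContinuousOnInterval h a b)
    (hd : ∀ᵐ t : ℝ, t ∈ Ioo a b → ∃ d, HasDerivAt h d t ∧ d ≤ 0) :
    h b ≤ h a := by
  have := hh.sub_le_integral hab (φ := fun _ => 0) (by simp) hd
  simp only [intervalIntegral.integral_zero] at this
  linarith

theorem AbsolutelyContinuousOnInterval.sub_eq_integral {h φ : ℝ → ℝ} {a b : ℝ} (hab : a ≤ b)
    (hh : AbsolutelyContinuousOnInterval h a b) (hφ : IntervalIntegrable φ volume a b)
    (hd : ∀ᵐ t : ℝ, t ∈ Ioo a b → HasDerivAt h (φ t) t) :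
    h b - h a = ∫ t in a..b, φ t := by
  refine le_antisymm (hh.sub_le_integral hab hφ ?_) ?_
  · filter_upwards [hd] with t ht hm using ⟨_, ht hm, le_rfl⟩
  · have := hh.neg.sub_le_integral hab hφ.neg ?_
    · simp only [Pi.neg_apply, intervalIntegral.integral_neg] at this
      linarith
    · filter_upwards [hd] with t ht hm using ⟨_, (ht hm).neg, le_rfl⟩

/-- A curve with bounded velocity is Lipschitz. -/
theorem AbsolutelyContinuousOnInterval.norm_sub_le_of_hasDerivAt {E : Type*}
    [NormedAddCommGroup E] [InnerProductSpace ℝ E] {γ : ℝ → E} {a b M : ℝ}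
    (hab : a ≤ b) (hγ : AbsolutelyContinuousOnInterval γ a b)
    (hd : ∀ᵐ t : ℝ, t ∈ Ioo a b → ∃ d, HasDerivAt γ d t ∧ ‖d‖ ≤ M) :
    ‖γ b - γ a‖ ≤ M * (b - a) := by
  -- Pairing the curve with its own increment reduces the bound to a scalar one, `‖v‖² ≤ ‖v‖ M (b -
  -- a)`.
  set v := γ b - γ a with hv
  have hac : AbsolutelyContinuousOnInterval (fun t => (innerSL ℝ v) (γ t)) a b :=
    (innerSL ℝ v).lipschitz.locallyLipschitz.comp_absolutelyContinuousOnInterval hγ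
  have h := hac.sub_le_integral hab (φ := fun _ => ‖v‖ * M) (by simp) (by
    filter_upwards [hd] with t ht hm
    obtain ⟨d, hd, hM⟩ := ht hm
    refine ⟨_, (innerSL ℝ v).hasFDerivAt.comp_hasDerivAt t hd, ?_⟩
    exact (real_inner_le_norm v d).trans (by gcongr))
  rw [← map_sub, innerSL_apply_apply, ← hv, real_inner_self_eq_norm_sq,
    intervalIntegral.integral_const, smul_eq_mul] at h
  rcases (norm_nonneg v).eq_or_lt with h0 | h0
  -- For zero increment, `0 ≤ M` is still needed; it comes from one point of differentiability,
  -- which exists when `a < b`.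
  · rw [← h0]
    rcases hab.eq_or_lt with rfl | hlt
    · simp
    · obtain ⟨t, ht⟩ : ∃ t, ∃ d, HasDerivAt γ d t ∧ ‖d‖ ≤ M := by
        by_contra! hcon
        have : ∀ᵐ t : ℝ, t ∉ Ioo a b := by
          filter_upwards [hd] with t ht hm
          obtain ⟨d, h1, h2⟩ := ht hm
          exact absurd h2 (not_le.2 (hcon t d h1))
        have := measure_eq_zero_iff_ae_notMem.2 this
        rw [Real.volume_Ioo, ENNReal.ofReal_eq_zero] at this
        linarith
      obtain ⟨d, -, hM⟩ := ht
      have := (norm_nonneg d).trans hM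
      exact mul_nonneg this (by linarith)
  · refine le_of_mul_le_mul_left ?_ h0
    nlinarith

/-- Barbalat's lemma. -/
theorem UniformContinuous.tendsto_zero_of_tendsto_integral {ψ : ℝ → ℝ} (hψ : UniformContinuous ψ)
    {a : ℝ} (h : Tendsto (fun t => ∫ s in (0 : ℝ)..t, ψ s) atTop (𝓝 a)) :
    Tendsto ψ atTop (𝓝 0) := by
  rw [Metric.tendsto_atTop]
  intro ε hε
  obtain ⟨δ, hδ, hψδ⟩ := Metric.uniformContinuous_iff.1 hψ (ε / 2) (by positivity)
  -- Integrals over windows of length `δ / 2` tend to `0`, while on such a window `ψ` stays within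
  -- `ε / 2` of its value at the left end.
  have hd : Tendsto (fun t => (∫ s in (0 : ℝ)..(t + δ / 2), ψ s) - ∫ s in (0 : ℝ)..t, ψ s) atTop
      (𝓝 (a - a)) := (h.comp (tendsto_atTop_add_const_right _ (δ / 2) tendsto_id)).sub h
  rw [sub_self, Metric.tendsto_atTop] at hd
  obtain ⟨N, hN⟩ := hd (δ / 2 * (ε / 2)) (by positivity)
  refine ⟨N, fun t ht => ?_⟩
  have h1 := hN t ht
  have hi : ∀ a b, IntervalIntegrable ψ volume a b := fun a b =>
    hψ.continuous.intervalIntegrable a b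
  rw [intervalIntegral.integral_interval_sub_left (hi _ _) (hi _ _), dist_zero_right] at h1
  have h2 : ‖∫ s in t..(t + δ / 2), (ψ s - ψ t)‖ ≤ ε / 2 * |t + δ / 2 - t| := by
    refine intervalIntegral.norm_integral_le_of_norm_le_const fun s hs => ?_
    rw [uIoc_of_le (by linarith)] at hs
    rw [← dist_eq_norm]
    refine (hψδ ?_).le
    rw [Real.dist_eq, abs_lt]
    constructor <;> linarith [hs.1, hs.2]
  rw [intervalIntegral.integral_sub (hi _ _) (by simp), intervalIntegral.integral_const,
    smul_eq_mul, add_sub_cancel_left, abs_of_pos (by positivity : 0 < δ / 2)] at h2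
  rw [dist_zero_right]
  rw [Real.norm_eq_abs] at *
  have h3 : |δ / 2 * ψ t| < δ / 2 * ε := by
    rw [abs_lt] at *
    rw [abs_le] at h2
    constructor <;> nlinarith [h1.1, h1.2, h2.1, h2.2]
  rw [abs_mul, abs_of_pos (by positivity : 0 < δ / 2)] at h3
  exact lt_of_mul_lt_mul_left h3 (by positivity)

end AbsoluteContinuity

/-! ### Global solvability of causal Lipschitz equations. -/

section CausalIntegralEquation

open scoped NNReal BoundedContinuousFunction

/-- An integral equation `u(t) = z₀ + ∫₀ᵗ Q(u)(s) ds` with a causal Lipschitz operator `Q` has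
a solution for all times. -/
theorem exists_eq_add_integral_of_causal_lipschitz {E : Type*} [NormedAddCommGroup E]
    [NormedSpace ℝ E] [CompleteSpace E] (Q : (ℝ → E) → ℝ → E) {B C : ℝ} (hC : 0 ≤ C)
    (hcont : ∀ u, Continuous u → Continuous (Q u))
    (hzero : ∀ t, ‖Q (fun _ => 0) t‖ ≤ B)
    (hlip : ∀ u v, Continuous u → Continuous v → ∀ t, 0 ≤ t → ∀ M,
      (∀ s ∈ Icc 0 t, ‖u s - v s‖ ≤ M) → ‖Q u t - Q v t‖ ≤ C * M) (z₀ : E) :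
    ∃ u : ℝ → E, Continuous u ∧ ∀ t, 0 ≤ t → u t = z₀ + ∫ s in (0 : ℝ)..t, Q u s := by
  -- Any `c > C` works: the contraction constant in the norm with weight `exp (-c t)` is `C / c`.
  set c : ℝ := C + 1 with hc
  have hc0 : 0 < c := by positivity
  have hB : 0 ≤ B := (norm_nonneg _).trans (hzero 0)
  have hexp : ∀ t : ℝ, ∫ s in (0 : ℝ)..t, Real.exp (c * s) = (Real.exp (c * t) - 1) / c := by
    intro t
    rw [intervalIntegral.integral_comp_mul_left (fun x => Real.exp x) hc0.ne', integral_exp,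
      mul_zero, Real.exp_zero, smul_eq_mul]
    ring
  -- A bounded function `v` encodes the path `exp (c s) v(s)`, so the sup distance of codes is the
  -- weighted distance of paths.
  let lift : (ℝ≥0 →ᵇ E) → ℝ → E := fun v s => Real.exp (c * s) • v s.toNNReal
  have lift_cont : ∀ v, Continuous (lift v) := fun v => by
    have := v.continuous.comp continuous_real_toNNReal
    exact (by fun_prop : Continuous fun s : ℝ => Real.exp (c * s)).smul this
  have bound : ∀ (u v : ℝ → E), Continuous u → Continuous v → ∀ D t : ℝ, 0 ≤ D → 0 ≤ t →
      (∀ s, 0 ≤ s → ‖u s - v s‖ ≤ D * Real.exp (c * s)) →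
      ‖∫ s in (0 : ℝ)..t, (Q u s - Q v s)‖ ≤ C / c * D * Real.exp (c * t) := by
    intro u v hu hv D t hD ht huv
    have h1 : ∀ s ∈ Ioc 0 t, ‖Q u s - Q v s‖ ≤ C * D * Real.exp (c * s) := fun s hs => by
      rw [mul_assoc]
      refine hlip u v hu hv s hs.1.le _ fun r hr => (huv r hr.1).trans ?_
      gcongr
      exact hr.2
    have h2 := intervalIntegral.norm_integral_le_of_norm_le (μ := volume) ht
      (Eventually.of_forall h1)
      ((by fun_prop : Continuous fun s : ℝ => C * D * Real.exp (c * s)).intervalIntegrable 0 t)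
    rw [intervalIntegral.integral_const_mul, hexp] at h2
    refine h2.trans ?_
    rw [show C / c * D * Real.exp (c * t) = C * D * (Real.exp (c * t) / c) by ring]
    gcongr
    linarith
  have int : ∀ u, Continuous u → ∀ t : ℝ, IntervalIntegrable (Q u) volume 0 t := fun u hu t =>
    (hcont u hu).intervalIntegrable 0 t
  have lift_norm : ∀ v w, ∀ s, 0 ≤ s → ‖lift v s - lift w s‖ ≤ dist v w * Real.exp (c * s) := by
    intro v w s _
    simp only [lift]
    rw [← smul_sub, norm_smul, Real.norm_of_nonneg (Real.exp_nonneg _), mul_comm, ← dist_eq_norm]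
    gcongr
    exact BoundedContinuousFunction.dist_coe_le_dist _
  let op : (ℝ≥0 →ᵇ E) → ℝ≥0 → E := fun v t =>
    Real.exp (-(c * t)) • (z₀ + ∫ s in (0 : ℝ)..t, Q (lift v) s)
  have op_cont : ∀ v, Continuous (op v) := fun v => by
    have h1 : Continuous fun t : ℝ => ∫ s in (0 : ℝ)..t, Q (lift v) s :=
      intervalIntegral.continuous_primitive
        (fun a b => (hcont _ (lift_cont v)).intervalIntegrable a b) 0
    have h2 : Continuous fun t : ℝ =>
        Real.exp (-(c * t)) • (z₀ + ∫ s in (0 : ℝ)..t, Q (lift v) s) := by fun_prop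
    exact h2.comp NNReal.continuous_coe
  have lift_zero : lift 0 = fun _ => 0 := by
    funext s
    simp [lift]
  have op_bound : ∀ v t, ‖op v t‖ ≤ ‖z₀‖ + (C / c * ‖v‖ + B / c) := by
    intro v t
    have hsplit : ∫ s in (0 : ℝ)..t, Q (lift v) s =
        (∫ s in (0 : ℝ)..t, (Q (lift v) s - Q (lift 0) s)) + ∫ s in (0 : ℝ)..t, Q (lift 0) s := by
      rw [intervalIntegral.integral_sub (int _ (lift_cont v) _) (int _ (lift_cont 0) _)]
      abel
    have h1 := bound _ _ (lift_cont v) (lift_cont 0) _ t dist_nonneg t.2 (lift_norm v 0)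
    rw [dist_zero_right] at h1
    have h2 : ‖∫ s in (0 : ℝ)..t, Q (lift 0) s‖ ≤ B / c * Real.exp (c * t) := by
      have := intervalIntegral.norm_integral_le_of_norm_le_const (a := 0) (b := t)
        (f := Q (lift 0)) (C := B) fun s _ => by rw [lift_zero]; exact hzero s
      rw [sub_zero, abs_of_nonneg (NNReal.coe_nonneg t)] at this
      refine this.trans ?_
      rw [div_mul_eq_mul_div, le_div_iff₀ hc0]
      have := Real.add_one_le_exp (c * t)
      nlinarith
    have h3 : (1 : ℝ) ≤ Real.exp (c * t) := Real.one_le_exp (by positivity)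
    simp only [op]
    rw [norm_smul, Real.norm_of_nonneg (Real.exp_nonneg _), Real.exp_neg, inv_mul_le_iff₀
      (Real.exp_pos _), hsplit]
    refine (norm_add_le _ _).trans ((add_le_add_right (norm_add_le _ _) _).trans ?_)
    nlinarith [norm_nonneg z₀]
  let Φ : (ℝ≥0 →ᵇ E) → (ℝ≥0 →ᵇ E) := fun v =>
    BoundedContinuousFunction.ofNormedAddCommGroup (op v) (op_cont v) _ (op_bound v)
  have hΦ : ContractingWith (NNReal.mk (C / c) (by positivity)) Φ := by
    refine ⟨?_, LipschitzWith.of_dist_le_mul fun v w => ?_⟩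
    · change C / c < 1
      rw [div_lt_one hc0]
      linarith
    · refine (BoundedContinuousFunction.dist_le (mul_nonneg (NNReal.coe_nonneg _)
        dist_nonneg)).2 fun t => ?_
      change dist (op v t) (op w t) ≤ C / c * dist v w
      have h1 := bound _ _ (lift_cont v) (lift_cont w) _ t dist_nonneg t.2 (lift_norm v w)
      rw [intervalIntegral.integral_sub (int _ (lift_cont v) _) (int _ (lift_cont w) _)] at h1
      simp only [op]
      rw [dist_eq_norm, ← smul_sub, add_sub_add_left_eq_sub, norm_smul,
        Real.norm_of_nonneg (Real.exp_nonneg _), Real.exp_neg, inv_mul_le_iff₀ (Real.exp_pos _)]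
      linarith
  obtain ⟨v, hv⟩ : ∃ v, Φ v = v := ⟨_, hΦ.fixedPoint_isFixedPt⟩
  refine ⟨lift v, lift_cont v, fun t ht => ?_⟩
  have h1 : op v (NNReal.mk t ht) = v (NNReal.mk t ht) := DFunLike.congr_fun hv _
  change Real.exp (c * t) • v t.toNNReal = _
  rw [Real.toNNReal_of_nonneg ht, ← h1]
  simp only [op, NNReal.coe_mk]
  rw [smul_smul, ← Real.exp_add, add_neg_cancel, Real.exp_zero, one_smul]

/-- `γ` has velocity `v` at time `t`. Over concrete spaces this fixes the normed-space structure
in which the derivative is taken. -/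
abbrev HasVelocity {E : Type*} [NormedAddCommGroup E] [NormedSpace ℝ E] (γ : ℝ → E) (v : E)
    (t : ℝ) : Prop :=
  HasDerivAt γ v t

theorem HasVelocity.clm_comp {E F : Type*} [NormedAddCommGroup E] [NormedSpace ℝ E]
    [NormedAddCommGroup F] [NormedSpace ℝ F] {γ : ℝ → E} {v : E} {t : ℝ} (h : HasVelocity γ v t)
    (L : E →L[ℝ] F) : HasVelocity (fun s => L (γ s)) (L v) t :=
  L.hasFDerivAt.comp_hasDerivAt t h

/-- The causal equation `u' = Q(u)` with initial value `z₀` has a solution for all times. -/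
theorem exists_hasVelocity_of_causal_lipschitz {E : Type*} [NormedAddCommGroup E]
    [NormedSpace ℝ E] [CompleteSpace E] (Q : (ℝ → E) → ℝ → E) {B C : ℝ} (hC : 0 ≤ C)
    (hcont : ∀ u, Continuous u → Continuous (Q u))
    (hzero : ∀ t, ‖Q (fun _ => 0) t‖ ≤ B)
    (hlip : ∀ u v, Continuous u → Continuous v → ∀ t, 0 ≤ t → ∀ M,
      (∀ s ∈ Icc 0 t, ‖u s - v s‖ ≤ M) → ‖Q u t - Q v t‖ ≤ C * M) (z₀ : E) :
    ∃ u : ℝ → E, Continuous u ∧ u 0 = z₀ ∧ (∀ t, 0 < t → HasVelocity u (Q u t) t) ∧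
      ∀ b, ∃ K, LipschitzOnWith K u (Icc 0 b) := by
  obtain ⟨u, hu, hint⟩ := exists_eq_add_integral_of_causal_lipschitz Q hC hcont hzero hlip z₀
  have hderiv : ∀ t, HasDerivAt (fun t => z₀ + ∫ s in (0 : ℝ)..t, Q u s) (Q u t) t := fun t =>
    ((hcont u hu).integral_hasStrictDerivAt 0 t).hasDerivAt.const_add z₀
  refine ⟨u, hu, by simpa using hint 0 le_rfl, fun t ht => ?_, fun b => ?_⟩
  · refine (hderiv t).congr_of_eventuallyEq ?_
    filter_upwards [lt_mem_nhds ht] with s hs using hint s hs.le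
  · obtain ⟨M, hM⟩ := isCompact_Icc.exists_bound_of_continuousOn (s := Icc 0 b)
      (hcont u hu).continuousOn
    have hlip : LipschitzOnWith M.toNNReal (fun t => z₀ + ∫ s in (0 : ℝ)..t, Q u s) (Icc 0 b) :=
      (convex_Icc 0 b).lipschitzOnWith_of_nnnorm_hasDerivWithin_le
        (fun t _ => (hderiv t).hasDerivWithinAt) fun t ht => by
          rw [← NNReal.coe_le_coe, coe_nnnorm]
          exact (hM t ht).trans (Real.le_coe_toNNReal M)
    refine ⟨M.toNNReal, fun s hs t ht => ?_⟩
    rw [hint s hs.1, hint t ht.1]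
    exact hlip hs ht

end CausalIntegralEquation

/-! ### One-dimensional Skorokhod reflection at zero. -/

section SkorokhodReflection

/-- The Skorokhod regulator `sup {max 0 (-u s) | s between 0 and t}`: the least increasing
function that keeps `u` nonnegative when added to it. -/
noncomputable def skorokhodRegulator (u : ℝ → ℝ) (t : ℝ) : ℝ :=
  sSup ((fun r => max 0 (-u (r * t))) '' Icc 0 1)

variable {u v : ℝ → ℝ}

/-- Rescaling time by `r ∈ [0, 1]` lets the supremum run over a compact set independent of `t`. -/
theorem continuous_skorokhodRegulator (hu : Continuous u) :
    Continuous (skorokhodRegulator u) :=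
  isCompact_Icc.continuous_sSup (f := fun t r => max 0 (-u (r * t)))
    (by simp only [Function.HasUncurry.uncurry]; fun_prop)

theorem skorokhodRegulator_le {t M : ℝ} (ht : 0 ≤ t) (hM : 0 ≤ M)
    (h : ∀ s ∈ Icc 0 t, -u s ≤ M) : skorokhodRegulator u t ≤ M := by
  refine csSup_le ((nonempty_Icc.2 zero_le_one).image _) ?_
  rintro _ ⟨r, hr, rfl⟩
  exact max_le hM (h _ ⟨mul_nonneg hr.1 ht, mul_le_of_le_one_left ht hr.2⟩)

theorem max_neg_le_skorokhodRegulator (hu : Continuous u) {s t : ℝ} (hs : s ∈ Icc 0 t) :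
    max 0 (-u s) ≤ skorokhodRegulator u t := by
  have hbdd : BddAbove ((fun r => max 0 (-u (r * t))) '' Icc 0 1) :=
    isCompact_Icc.bddAbove_image (by fun_prop)
  have ht : 0 ≤ t := hs.1.trans hs.2
  refine le_csSup hbdd ⟨s / t, ⟨div_nonneg hs.1 ht, div_le_one_of_le₀ hs.2 ht⟩, ?_⟩
  rcases ht.eq_or_lt with h0 | h0
  · have : s = t := le_antisymm hs.2 (h0 ▸ hs.1)
    simp [this, ← h0]
  · simp [div_mul_cancel₀ s h0.ne']

theorem skorokhodRegulator_nonneg (hu : Continuous u) {t : ℝ} (ht : 0 ≤ t) :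
    0 ≤ skorokhodRegulator u t :=
  (le_max_left _ _).trans (max_neg_le_skorokhodRegulator hu (right_mem_Icc.2 ht))

theorem neg_le_skorokhodRegulator (hu : Continuous u) {s t : ℝ} (hs : s ∈ Icc 0 t) :
    -u s ≤ skorokhodRegulator u t :=
  (le_max_right _ _).trans (max_neg_le_skorokhodRegulator hu hs)

theorem skorokhodRegulator_zero (h : 0 ≤ u 0) : skorokhodRegulator u 0 = 0 := by
  simp [skorokhodRegulator, h]

/-- The regulator of one path, raised by `M`, dominates the negative of the other path. This makes
reflection a causal Lipschitz operator. -/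
theorem skorokhodRegulator_sub_le (hu : Continuous u) (hv : Continuous v) {t M : ℝ} (ht : 0 ≤ t)
    (h : ∀ s ∈ Icc 0 t, |u s - v s| ≤ M) :
    |skorokhodRegulator u t - skorokhodRegulator v t| ≤ M := by
  have hM : 0 ≤ M := (abs_nonneg _).trans (h 0 (left_mem_Icc.2 ht))
  rw [abs_le]
  constructor
  · have := skorokhodRegulator_le (u := v) ht (add_nonneg (skorokhodRegulator_nonneg hu ht) hM)
      fun s hs => by linarith [neg_le_skorokhodRegulator hu hs, (abs_le.1 (h s hs)).2]
    linarith
  · have := skorokhodRegulator_le (u := u) ht (add_nonneg (skorokhodRegulator_nonneg hv ht) hM)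
      fun s hs => by linarith [neg_le_skorokhodRegulator hv hs, (abs_le.1 (h s hs)).1]
    linarith

theorem monotoneOn_skorokhodRegulator (hu : Continuous u) :
    MonotoneOn (skorokhodRegulator u) (Ici 0) := fun _s hs _t _ hst =>
  skorokhodRegulator_le hs (skorokhodRegulator_nonneg hu (le_trans hs hst)) fun _ hr =>
    neg_le_skorokhodRegulator hu ⟨hr.1, hr.2.trans hst⟩

/-- The regulator grows only by as much as `u` falls below its earlier minimum. This transfers
absolute continuity to the reflected path. -/
theorem lipschitzOnWith_skorokhodRegulator (hu : Continuous u) {b : ℝ} {K : NNReal}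
    (h : LipschitzOnWith K u (Icc 0 b)) : LipschitzOnWith K (skorokhodRegulator u) (Icc 0 b) := by
  have key : ∀ s ∈ Icc 0 b, ∀ t ∈ Icc 0 b, s ≤ t →
      skorokhodRegulator u t ≤ skorokhodRegulator u s + K * (t - s) := by
    intro s hs t ht hst
    have hp : 0 ≤ K * (t - s) := mul_nonneg K.2 (sub_nonneg.2 hst)
    refine skorokhodRegulator_le ht.1 (add_nonneg (skorokhodRegulator_nonneg hu hs.1) hp)
      fun r hr => ?_
    rcases le_total r s with hrs | hrs
    · linarith [neg_le_skorokhodRegulator hu ⟨hr.1, hrs⟩]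
    · have h1 := h.dist_le_mul r ⟨hr.1, hr.2.trans ht.2⟩ s hs
      rw [Real.dist_eq, Real.dist_eq, abs_of_nonneg (sub_nonneg.2 hrs)] at h1
      have h2 := neg_le_skorokhodRegulator hu (right_mem_Icc.2 hs.1)
      have h3 : (K : ℝ) * (r - s) ≤ K * (t - s) := by gcongr; exact hr.2
      linarith [(abs_le.1 h1).1]
  refine LipschitzOnWith.of_dist_le_mul fun s hs t ht => ?_
  rw [Real.dist_eq, Real.dist_eq]
  rcases le_total s t with hst | hst
  · have hm := monotoneOn_skorokhodRegulator hu hs.1 ht.1 hst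
    rw [abs_sub_comm, abs_of_nonneg (sub_nonneg.2 hm), abs_sub_comm,
      abs_of_nonneg (sub_nonneg.2 hst)]
    linarith [key s hs t ht hst]
  · have hm := monotoneOn_skorokhodRegulator hu ht.1 hs.1 hst
    rw [abs_of_nonneg (sub_nonneg.2 hm), abs_of_nonneg (sub_nonneg.2 hst)]
    linarith [key t ht s hs hst]

/-- While the reflected function is positive, the regulator is constant. -/
theorem skorokhodRegulator_eventually_eq (hu : Continuous u) {t : ℝ} (ht : 0 < t)
    (hpos : 0 < u t + skorokhodRegulator u t) :
    skorokhodRegulator u =ᶠ[𝓝 t] fun _ => skorokhodRegulator u t := by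
  -- Two independent times are used: near `t`, every value `-u r` is below every regulator value, so
  -- it cannot raise the running supremum.
  have hcont : ContinuousAt (fun q : ℝ × ℝ => u q.1 + skorokhodRegulator u q.2) (t, t) := by
    have := continuous_skorokhodRegulator hu
    fun_prop
  have hev := hcont.eventually_const_lt hpos
  obtain ⟨δ, hδ, hball⟩ := Metric.eventually_nhds_iff.1 hev
  have hpair : ∀ r s, |r - t| < δ → |s - t| < δ → -u r < skorokhodRegulator u s := by
    intro r s hr hs
    have := hball (y := (r, s)) (by simpa [Prod.dist_eq, Real.dist_eq] using ⟨hr, hs⟩)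
    dsimp only at this
    linarith
  have key : ∀ s s', 0 < s → |s - t| < δ → |s' - t| < δ → s ≤ s' →
      skorokhodRegulator u s' = skorokhodRegulator u s := by
    intro s s' h0 hs hs' hss
    refine le_antisymm (skorokhodRegulator_le (h0.le.trans hss)
      (skorokhodRegulator_nonneg hu h0.le) fun r hr => ?_)
      (monotoneOn_skorokhodRegulator hu h0.le (h0.le.trans hss) hss)
    rcases le_total r s with hrs | hrs
    · exact neg_le_skorokhodRegulator hu ⟨hr.1, hrs⟩
    · refine (hpair r s ?_ hs).le
      rw [abs_lt] at *
      constructor <;> linarith [hr.2]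
  have hself : |t - t| < δ := by simpa
  filter_upwards [Metric.ball_mem_nhds t hδ, lt_mem_nhds ht] with s hs h0
  rw [Metric.mem_ball, Real.dist_eq] at hs
  rcases le_total s t with hst | hst
  · exact (key s t h0 hs hself hst).symm
  · exact key t s ht hself hs hst

/-- Almost everywhere, the reflection of `u` has derivative `[u']⁺`. -/
theorem ae_hasDerivAt_add_skorokhodRegulator (hu : Continuous u) {u' : ℝ → ℝ}
    (hd : ∀ t, 0 < t → HasDerivAt u (u' t) t) :
    ∀ᵐ t : ℝ, 0 < t → HasDerivAt (fun s => u s + skorokhodRegulator u s)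
      (PrimalDual.plusProj (u' t) (u t + skorokhodRegulator u t)) t := by
  -- Lebesgue's theorem on monotone functions; the exceptional null set arises only here.
  filter_upwards [(monotoneOn_skorokhodRegulator hu).ae_differentiableWithinAt_of_mem]
    with t hp ht
  have hp := (hp ht.le).differentiableAt (Ici_mem_nhds ht)
  have hnn : ∀ s, 0 ≤ s → 0 ≤ u s + skorokhodRegulator u s := fun s hs => by
    linarith [neg_le_skorokhodRegulator hu (right_mem_Icc.2 hs)]
  unfold PrimalDual.plusProj
  split_ifs with hpos
  · have h1 := (hasDerivAt_const t (skorokhodRegulator u t)).congr_of_eventuallyEq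
      (skorokhodRegulator_eventually_eq hu ht hpos)
    have h2 := (hd t ht).add h1
    rwa [add_zero] at h2
  · have hz : u t + skorokhodRegulator u t = 0 := le_antisymm (not_lt.1 hpos) (hnn t ht.le)
    have hsum := (hd t ht).add hp.hasDerivAt
    -- A nonnegative function has a minimum where it vanishes, so its derivative is `0`. As the
    -- regulator increases, `u' ≤ 0`, and this derivative is `max 0 u'`.
    have hmin : IsLocalMin (fun s => u s + skorokhodRegulator u s) t := by
      filter_upwards [lt_mem_nhds ht] with s hs
      rw [hz]
      exact hnn s hs.le
    have hzero : u' t + deriv (skorokhodRegulator u) t = 0 := hmin.hasDerivAt_eq_zero hsum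
    have hmono : 0 ≤ deriv (skorokhodRegulator u) t := by
      rw [← derivWithin_of_mem_nhds (Ici_mem_nhds ht)]
      exact (monotoneOn_skorokhodRegulator hu).derivWithin_nonneg
    rw [max_eq_left (by linarith), ← hzero]
    exact hsum

end SkorokhodReflection

/-! ### Tangent inequalities for convex and concave functions. -/

section GradientInequality

variable {E : Type*} [NormedAddCommGroup E] [InnerProductSpace ℝ E] [CompleteSpace E]

theorem ConvexOn.add_inner_gradient_le {f : E → ℝ} (hf : ConvexOn ℝ univ f) {x : E}
    (hd : DifferentiableAt ℝ f x) (y : E) : f x + inner ℝ (gradient f x) (y - x) ≤ f y := by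
  have hline := hf.comp_affineMap (AffineMap.lineMap x y : ℝ →ᵃ[ℝ] E)
  have hderiv : HasDerivAt (f ∘ (AffineMap.lineMap x y : ℝ →ᵃ[ℝ] E))
      (inner ℝ (gradient f x) (y - x)) 0 := by
    rw [inner_gradient_left]
    exact HasFDerivAt.comp_hasDerivAt 0 (by simpa using hd.hasFDerivAt) AffineMap.hasDerivAt_lineMap
  have := hline.le_slope_of_hasDerivAt (mem_univ 0) (mem_univ 1) zero_lt_one hderiv
  simp only [slope_def_field, Function.comp_apply, AffineMap.lineMap_apply_one,
    AffineMap.lineMap_apply_zero, sub_zero, div_one] at this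
  linarith

theorem gradient_fun_neg (f : E → ℝ) (x : E) : gradient (fun y => -f y) x = -gradient f x := by
  simp [gradient, fderiv_fun_neg]

theorem ConcaveOn.le_add_inner_gradient {f : E → ℝ} (hf : ConcaveOn ℝ univ f) {x : E}
    (hd : DifferentiableAt ℝ f x) (y : E) : f y ≤ f x + inner ℝ (gradient f x) (y - x) := by
  have := hf.neg.add_inner_gradient_le hd.neg y
  have h := gradient_fun_neg f x
  simp only [Pi.neg_def] at this
  rw [h, inner_neg_left] at this
  linarith

end GradientInequality

namespace PrimalDual

/-! ### Lagrange multipliers and saddle points. -/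

section Duality

variable {n m : ℕ} {f : EuclideanSpace ℝ (Fin n) → ℝ}
  {g : EuclideanSpace ℝ (Fin n) → EuclideanSpace ℝ (Fin m)}

/-- Gives a unique maximizer in `x` at a fixed multiplier, which later pins down the limit of the
primal component. -/
theorem strictConcaveOn_lagrangian (hf : StrictConcaveOn ℝ univ f)
    (hg : ∀ i, ConvexOn ℝ univ (fun x => g x i)) {lam : EuclideanSpace ℝ (Fin m)}
    (hlam : ∀ i, 0 ≤ lam i) : StrictConcaveOn ℝ univ (fun x => lagrangian f g x lam) := by
  refine ⟨convex_univ, fun x _ y _ hxy a b ha hb hab => ?_⟩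
  have h1 := hf.2 (mem_univ x) (mem_univ y) hxy ha hb hab
  have h2 : ∑ i, lam i * g (a • x + b • y) i ≤
      a * ∑ i, lam i * g x i + b * ∑ i, lam i * g y i := by
    rw [Finset.mul_sum, Finset.mul_sum, ← Finset.sum_add_distrib]
    refine Finset.sum_le_sum fun i _ => ?_
    have := mul_le_mul_of_nonneg_left ((hg i).2 (mem_univ x) (mem_univ y) ha.le hb.le hab) (hlam i)
    simp only [smul_eq_mul] at this
    linarith
  simp only [lagrangian, smul_eq_mul] at h1 ⊢
  linarith

theorem IsPrimalOptimizer.le_lagrangian {x : EuclideanSpace ℝ (Fin n)} (hx : ∀ i, g x i ≤ 0)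
    {lam : EuclideanSpace ℝ (Fin m)} (hlam : ∀ i, 0 ≤ lam i) : f x ≤ lagrangian f g x lam := by
  have : ∑ i, lam i * g x i ≤ 0 :=
    Finset.sum_nonpos fun i _ => mul_nonpos_of_nonneg_of_nonpos (hlam i) (hx i)
  unfold lagrangian
  linarith

/-- Under Slater's condition an optimizer has a Lagrange multiplier. -/
theorem IsPrimalOptimizer.exists_multiplier (hf : ConcaveOn ℝ univ f)
    (hg : ∀ i, ConvexOn ℝ univ (fun x => g x i)) (h_slater : ∃ x, ∀ i, g x i < 0)
    {x : EuclideanSpace ℝ (Fin n)} (hx : IsPrimalOptimizer f g x) :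
    ∃ lam : EuclideanSpace ℝ (Fin m), (∀ i, 0 ≤ lam i) ∧ ∀ y, lagrangian f g y lam ≤ f x := by
  -- Perturbed constraint levels paired with values beaten at that level. Strict inequalities make
  -- `A` open, and optimality keeps `(0, f x)` outside.
  let A : Set ((Fin m → ℝ) × ℝ) := {p | ∃ y, (∀ i, g y i < p.1 i) ∧ p.2 < f y}
  have hA_convex : Convex ℝ A := by
    rintro p ⟨y, hy, hy'⟩ q ⟨z, hz, hz'⟩ a b ha hb hab
    refine ⟨a • y + b • z, fun i => ?_, ?_⟩
    · refine ((hg i).2 (mem_univ y) (mem_univ z) ha hb hab).trans_lt ?_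
      simp only [smul_eq_mul, Prod.fst_add, Prod.smul_fst, Pi.add_apply, Pi.smul_apply]
      have h1 := hy i
      have h2 := hz i
      rcases ha.eq_or_lt with rfl | ha
      · have : b = 1 := by linarith
        subst this
        linarith
      · nlinarith [mul_lt_mul_of_pos_left h1 ha, mul_le_mul_of_nonneg_left h2.le hb]
    · refine lt_of_lt_of_le ?_ (hf.2 (mem_univ y) (mem_univ z) ha hb hab)
      simp only [smul_eq_mul, Prod.snd_add, Prod.smul_snd]
      rcases ha.eq_or_lt with rfl | ha
      · have : b = 1 := by linarith
        subst this
        linarith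
      · nlinarith [mul_lt_mul_of_pos_left hy' ha, mul_le_mul_of_nonneg_left hz'.le hb]
  have hA_open : IsOpen A := by
    have : A = ⋃ y, ({p | ∀ i, g y i < p.1 i} ∩ {p | p.2 < f y}) := by
      ext p
      simp [A]
    rw [this]
    refine isOpen_iUnion fun y => IsOpen.inter ?_ (isOpen_lt continuous_snd continuous_const)
    simp only [ofPred_forall]
    exact isOpen_iInter_of_finite fun i => isOpen_lt continuous_const (by fun_prop)
  have hx_notMem : ((0, f x) : (Fin m → ℝ) × ℝ) ∉ A := by
    rintro ⟨y, hy, hy'⟩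
    exact absurd (hx.2 y fun i => (hy i).le) (not_le.2 hy')
  obtain ⟨φ, hφ⟩ := geometric_hahn_banach_open_point hA_convex hA_open hx_notMem
  set a : Fin m → ℝ := fun i => φ (Pi.single i 1, 0) with ha
  set b : ℝ := φ (0, 1) with hb
  have hφ_apply : ∀ y r, φ (y, r) = ∑ i, y i * a i + r * b := by
    intro y r
    have h1 : ((y, r) : (Fin m → ℝ) × ℝ) =
        (∑ i, y i • ((Pi.single i 1, 0) : (Fin m → ℝ) × ℝ)) + r • (0, 1) := by
      ext i
      · simp [Prod.fst_sum, Finset.sum_apply, Pi.single_apply]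
      · simp [Prod.snd_sum]
    rw [h1, map_add, map_sum, map_smul, smul_eq_mul]
    simp only [map_smul, smul_eq_mul, ha, hb]
  obtain ⟨s, hs⟩ := h_slater
  -- Slater's point puts into `A` a point directly below `(0, f x)`, so the hyperplane is not
  -- vertical.
  have hb_pos : 0 < b := by
    have := hφ (0, min (f s) (f x) - 1) ⟨s, hs, by simp; linarith [min_le_left (f s) (f x)]⟩
    rw [hφ_apply, hφ_apply] at this
    simp only [Pi.zero_apply, zero_mul, Finset.sum_const_zero, zero_add] at this
    have h2 := min_le_right (f s) (f x)
    nlinarith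
  have ha_nonpos : ∀ i, a i ≤ 0 := by
    intro i
    by_contra! hpos
    -- Large enough that `t * a i + (f s - 1) * b ≥ f x * b`, against the separation.
    set t : ℝ := max 0 ((f x - (f s - 1)) * b / a i) with ht
    have h0 : 0 ≤ t := le_max_left _ _
    have hmem : ((Pi.single i t, f s - 1) : (Fin m → ℝ) × ℝ) ∈ A := by
      refine ⟨s, fun j => (hs j).trans_le ?_, by simp⟩
      by_cases h : j = i
      · subst h
        simpa using h0
      · simp [h]
    have := hφ _ hmem
    rw [hφ_apply, hφ_apply] at this
    simp only [Pi.single_apply, ite_mul, zero_mul, Finset.sum_ite_eq', Finset.mem_univ, if_true,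
      Pi.zero_apply, Finset.sum_const_zero, zero_add] at this
    have h1 : (f x - (f s - 1)) * b / a i ≤ t := le_max_right _ _
    rw [div_le_iff₀ hpos] at h1
    linarith
  refine ⟨WithLp.toLp 2 fun i => -a i / b, fun i => div_nonneg (neg_nonneg.2 (ha_nonpos i))
    hb_pos.le, fun y => ?_⟩
  -- `(g y, f y)` itself is not in `A`; it is approached by the points `(g y + ε, f y - ε)`.
  have hlim : Tendsto (fun ε : ℝ => ∑ i, (g y i + ε) * a i + (f y - ε) * b) (𝓝[>] 0)
      (𝓝 (∑ i, (g y i + 0) * a i + (f y - 0) * b)) :=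
    ((by fun_prop : Continuous fun ε : ℝ =>
      ∑ i, (g y i + ε) * a i + (f y - ε) * b).tendsto 0).mono_left nhdsWithin_le_nhds
  have hle := le_of_tendsto hlim (b := f x * b) (by
    filter_upwards [self_mem_nhdsWithin] with ε hε
    have := hφ (fun i => g y i + ε, f y - ε) ⟨y, fun i => by simpa using hε, by simpa using hε⟩
    rw [hφ_apply, hφ_apply] at this
    simp only [Pi.zero_apply, zero_mul, Finset.sum_const_zero, zero_add] at this
    exact this.le)
  simp only [add_zero, sub_zero] at hle
  have hsum : ∑ i, (-a i / b) * g y i = -(∑ i, g y i * a i) / b := by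
    rw [neg_div, Finset.sum_div, ← Finset.sum_neg_distrib]
    exact Finset.sum_congr rfl fun i _ => by ring
  simp only [lagrangian]
  rw [hsum, sub_le_iff_le_add, ← mul_le_mul_iff_left₀ hb_pos, add_mul, div_mul_cancel₀ _ hb_pos.ne']
  linarith

theorem mem_saddlePoints_of_le {x : EuclideanSpace ℝ (Fin n)} {lam : EuclideanSpace ℝ (Fin m)}
    (hx : ∀ i, g x i ≤ 0) (hlam : ∀ i, 0 ≤ lam i) (h : ∀ y, lagrangian f g y lam ≤ f x) :
    (WithLp.toLp 2 (x, lam) : State n m) ∈ saddlePoints f g :=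
  ⟨hlam, fun y => (h y).trans (IsPrimalOptimizer.le_lagrangian hx hlam), fun _ hmu =>
    (h x).trans (IsPrimalOptimizer.le_lagrangian hx hmu)⟩

/-- Saddle points are feasible and satisfy complementary slackness. -/
theorem feasible_of_mem_saddlePoints {z : State n m} (hz : z ∈ saddlePoints f g) :
    (∀ i, g z.fst i ≤ 0) ∧ lagrangian f g z.fst z.snd = f z.fst := by
  obtain ⟨hdom, -, h⟩ := hz
  have hfeas : ∀ i, g z.fst i ≤ 0 := by
    intro i
    -- Raising one multiplier by `1` changes `L` by `-g z.fst i`.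
    have := h (z.snd + EuclideanSpace.single i 1) fun j => by
      have : (0 : ℝ) ≤ if j = i then 1 else 0 := by split_ifs <;> norm_num
      simpa [Pi.single_apply] using add_nonneg (hdom j) this
    simp [lagrangian, add_mul, Finset.sum_add_distrib] at this
    linarith
  refine ⟨hfeas, le_antisymm ?_ (IsPrimalOptimizer.le_lagrangian hfeas hdom)⟩
  simpa [lagrangian] using h 0 (by simp)

theorem primalDualOptimizers_eq_saddlePoints (hf : ConcaveOn ℝ univ f)
    (hg : ∀ i, ConvexOn ℝ univ (fun x => g x i)) (h_slater : ∃ x, ∀ i, g x i < 0) :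
    primalDualOptimizers f g = saddlePoints f g := by
  ext z
  constructor
  · rintro ⟨hx, hlam, hdual⟩
    obtain ⟨mu, hmu, hle⟩ := hx.exists_multiplier hf hg h_slater
    refine mem_saddlePoints_of_le hx.1 hlam fun y => ?_
    -- Strong duality: the dual value at `mu`, hence the optimal one, is at most the primal value.
    have h1 : dualFunction f g z.snd ≤ f z.fst :=
      (hdual mu hmu).trans (iSup_le fun y => EReal.coe_le_coe_iff.2 (hle y))
    exact EReal.coe_le_coe_iff.1
      ((le_iSup (fun y => (lagrangian f g y z.snd : EReal)) y).trans h1)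
  · intro hz
    obtain ⟨hfeas, heq⟩ := feasible_of_mem_saddlePoints hz
    obtain ⟨hdom, hmax, hmin⟩ := hz
    refine ⟨⟨hfeas, fun y hy => ?_⟩, hdom, fun mu hmu => ?_⟩
    · exact (IsPrimalOptimizer.le_lagrangian hy hdom).trans ((hmax y).trans heq.le)
    · exact (iSup_le fun y => EReal.coe_le_coe_iff.2 ((hmax y).trans (hmin mu hmu))).trans
        (le_iSup (fun y => (lagrangian f g y mu : EReal)) z.fst)

theorem saddlePoints_nonempty (hf : ConcaveOn ℝ univ f) (hg : ∀ i, ConvexOn ℝ univ (fun x => g x i))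
    (h_slater : ∃ x, ∀ i, g x i < 0) (h_opt : ∃ x, IsPrimalOptimizer f g x) :
    (saddlePoints f g).Nonempty := by
  obtain ⟨x, hx⟩ := h_opt
  obtain ⟨lam, hlam, hle⟩ := hx.exists_multiplier hf hg h_slater
  exact ⟨_, mem_saddlePoints_of_le hx.1 hlam hle⟩

end Duality

/-! ### The saddle-point field, its projection, and monotonicity. -/

section SaddleField

variable {n m : ℕ} {f : EuclideanSpace ℝ (Fin n) → ℝ}
  {g : EuclideanSpace ℝ (Fin n) → EuclideanSpace ℝ (Fin m)}

/-- The unprojected saddle-point vector field `(∇ₓL, -∇_λ L)`. -/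
noncomputable def saddleField (f : EuclideanSpace ℝ (Fin n) → ℝ)
    (g : EuclideanSpace ℝ (Fin n) → EuclideanSpace ℝ (Fin m)) (z : State n m) : State n m :=
  WithLp.toLp 2
    (gradient f z.fst - ∑ i, z.snd i • gradient (fun y => g y i) z.fst, g z.fst)

/-- The velocity `v` at `z` with `[·]⁺` applied to its multiplier components. -/
noncomputable def projectVelocity (v z : State n m) : State n m :=
  WithLp.toLp 2 (v.fst, WithLp.toLp 2 fun i => plusProj (v.snd i) (z.snd i))

theorem primalDualField_eq (z : State n m) :
    primalDualField f g z = projectVelocity (saddleField f g z) z := rfl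

theorem projectVelocity_snd (v z : State n m) (i : Fin m) :
    (projectVelocity v z).snd i = plusProj (v.snd i) (z.snd i) := rfl

theorem continuous_state_fst : Continuous fun z : State n m => z.fst := by fun_prop

theorem continuous_state_snd (i : Fin m) : Continuous fun z : State n m => z.snd i := by fun_prop

theorem isClosed_domain : IsClosed (domain n m) := by
  simp only [domain, ofPred_forall]
  exact isClosed_iInter fun i => isClosed_le continuous_const (continuous_state_snd i)

theorem state_inner_eq (w z : State n m) :
    inner ℝ w z = inner ℝ w.fst z.fst + ∑ i, w.snd i * z.snd i := by
  rw [WithLp.prod_inner_apply]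
  congr 1
  simp [PiLp.inner_apply, mul_comm]

theorem state_norm_sq_eq (z : State n m) : ‖z‖ ^ 2 = ‖z.fst‖ ^ 2 + ∑ i, z.snd i ^ 2 := by
  rw [WithLp.prod_norm_sq_eq_of_L2, EuclideanSpace.real_norm_sq_eq z.snd]

theorem norm_projectVelocity_le (v z : State n m) : ‖projectVelocity v z‖ ≤ ‖v‖ := by
  refine le_of_sq_le_sq ?_ (norm_nonneg _)
  rw [state_norm_sq_eq, state_norm_sq_eq]
  refine add_le_add le_rfl (Finset.sum_le_sum fun i _ => ?_)
  rw [projectVelocity_snd, plusProj]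
  split_ifs
  · exact le_rfl
  · rcases le_total (v.snd i) 0 with h | h
    · rw [max_eq_left h]
      nlinarith
    · rw [max_eq_right h]

/-- Projection changes component `i` only where `z.snd i = 0`. There `z - w` has component `-w.snd i
≤ 0`, and the velocity is only increased. -/
theorem inner_sub_projectVelocity_le {z w : State n m} (hz : z ∈ domain n m)
    (hw : w ∈ domain n m) (v : State n m) :
    inner ℝ (z - w) (projectVelocity v z) ≤ inner ℝ (z - w) v := by
  rw [state_inner_eq, state_inner_eq]
  refine add_le_add le_rfl (Finset.sum_le_sum fun i _ => ?_)
  rw [projectVelocity_snd, plusProj]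
  simp only [WithLp.sub_snd, PiLp.sub_apply]
  split_ifs with h
  · exact le_rfl
  · have h0 : z.snd i = 0 := le_antisymm (not_lt.1 h) (hz i)
    have h1 := hw i
    have h2 := le_max_right 0 (v.snd i)
    rw [h0]
    nlinarith

theorem locallyLipschitz_saddleField (hg : ContDiff ℝ 1 g)
    (hf_lip : LocallyLipschitz (gradient f))
    (hg_lip : ∀ i, LocallyLipschitz (gradient (fun x => g x i))) :
    LocallyLipschitz (saddleField f g) := by
  have hfst : LocallyLipschitz fun z : State n m => z.fst :=
    ((ContinuousLinearMap.fst ℝ _ _).comp (WithLp.prodContinuousLinearEquiv 2 ℝ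
      (EuclideanSpace ℝ (Fin n)) (EuclideanSpace ℝ (Fin m))).toContinuousLinearMap).lipschitz
      |>.locallyLipschitz
  have hsnd : ∀ i, LocallyLipschitz fun z : State n m => z.snd i := fun i =>
    ((EuclideanSpace.proj i).comp ((ContinuousLinearMap.snd ℝ _ _).comp
      (WithLp.prodContinuousLinearEquiv 2 ℝ (EuclideanSpace ℝ (Fin n))
        (EuclideanSpace ℝ (Fin m))).toContinuousLinearMap)).lipschitz.locallyLipschitz
  have hsum : ∀ s : Finset (Fin m), LocallyLipschitz fun z : State n m =>
      ∑ i ∈ s, z.snd i • gradient (fun y => g y i) z.fst := by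
    intro s
    induction s using Finset.induction_on with
    | empty => simpa using LocallyLipschitz.const _
    | insert i s hi ih =>
      simp only [Finset.sum_insert hi]
      refine LocallyLipschitz.add ?_ ih
      exact (contDiff_smul (𝕜 := ℝ) (n := 1)).locallyLipschitz.comp
        ((hsnd i).prodMk ((hg_lip i).comp hfst))
  have hpair := ((hf_lip.comp hfst).sub (hsum Finset.univ)).prodMk (hg.locallyLipschitz.comp hfst)
  exact (WithLp.prodContinuousLinearEquiv 2 ℝ (EuclideanSpace ℝ (Fin n))
    (EuclideanSpace ℝ (Fin m))).symm.lipschitz.locallyLipschitz.comp hpair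

theorem continuous_lagrangian (hf : Continuous f) (hg : Continuous g) :
    Continuous fun p : EuclideanSpace ℝ (Fin n) × EuclideanSpace ℝ (Fin m) =>
      lagrangian f g p.1 p.2 := by
  unfold lagrangian
  fun_prop

/-- Besides the energy estimate, this shows that a point stationary in `x` maximizes `L` over `x`.
-/
theorem lagrangian_le_add_inner (hf : ContDiff ℝ 1 f) (hg : ContDiff ℝ 1 g)
    (hf_concave : ConcaveOn ℝ univ f) (hg_convex : ∀ i, ConvexOn ℝ univ (fun x => g x i))
    {z : State n m} (hz : z ∈ domain n m) (y : EuclideanSpace ℝ (Fin n)) :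
    lagrangian f g y z.snd ≤ lagrangian f g z.fst z.snd +
      inner ℝ (saddleField f g z).fst (y - z.fst) := by
  have h1 := hf_concave.le_add_inner_gradient (hf.differentiable one_ne_zero z.fst) y
  have h2 : ∑ i, z.snd i * (g z.fst i + inner ℝ (gradient (fun x => g x i) z.fst) (y - z.fst)) ≤
      ∑ i, z.snd i * g y i := by
    refine Finset.sum_le_sum fun i _ => mul_le_mul_of_nonneg_left ?_ (hz i)
    have hd : Differentiable ℝ fun x => g x i :=
      (EuclideanSpace.proj (𝕜 := ℝ) i).differentiable.comp (hg.differentiable one_ne_zero)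
    exact (hg_convex i).add_inner_gradient_le (hd z.fst) y
  simp only [mul_add, Finset.sum_add_distrib] at h2
  have h3 : (saddleField f g z).fst =
    gradient f z.fst - ∑ i, z.snd i • gradient (fun y => g y i) z.fst := rfl
  rw [h3, inner_sub_left, sum_inner]
  simp only [real_inner_smul_left, lagrangian]
  linarith

theorem inner_sub_saddleField_le (hf : ContDiff ℝ 1 f) (hg : ContDiff ℝ 1 g)
    (hf_concave : ConcaveOn ℝ univ f) (hg_convex : ∀ i, ConvexOn ℝ univ (fun x => g x i))
    {z : State n m} (hz : z ∈ domain n m) (w : State n m) :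
    inner ℝ (z - w) (saddleField f g z) ≤
      lagrangian f g z.fst w.snd - lagrangian f g w.fst z.snd := by
  have h1 := lagrangian_le_add_inner hf hg hf_concave hg_convex hz w.fst
  rw [state_inner_eq, real_inner_comm]
  simp only [WithLp.sub_fst, WithLp.sub_snd, PiLp.sub_apply, sub_mul, Finset.sum_sub_distrib]
  have h2 : (saddleField f g z).snd = g z.fst := rfl
  rw [h2]
  rw [← neg_sub, inner_neg_right]
  simp only [lagrangian] at *
  linarith

end SaddleField

/-! ### Projected dynamics by reflection of the multipliers. -/

section ReflectedSolution

variable {n m : ℕ}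

theorem norm_toLp_zero_le (d : EuclideanSpace ℝ (Fin m)) {M : ℝ} (h : ∀ i, |d i| ≤ M) :
    ‖(WithLp.toLp 2 (0, d) : State n m)‖ ≤ m * M := by
  have h1 : ‖(WithLp.toLp 2 (0, d) : State n m)‖ = ‖d‖ := by
    rw [WithLp.prod_norm_eq_of_L2]
    simp
  have h2 : d = ∑ i, d i • EuclideanSpace.single i (1 : ℝ) := by
    ext j
    simp [Pi.single_apply]
  rw [h1, h2]
  refine (norm_sum_le _ _).trans ((Finset.sum_le_card_nsmul _ _ M fun i _ => ?_).trans (by simp))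
  rw [norm_smul]
  simpa using h i

/-- The path `u` with each multiplier component reflected at `0`. -/
noncomputable def reflectedPath (u : ℝ → State n m) (t : ℝ) : State n m :=
  u t + WithLp.toLp 2 (0, WithLp.toLp 2 fun i => skorokhodRegulator (fun s => (u s).snd i) t)

theorem reflectedPath_snd (u : ℝ → State n m) (t : ℝ) (i : Fin m) :
    (reflectedPath u t).snd i = (u t).snd i + skorokhodRegulator (fun s => (u s).snd i) t := rfl

variable {u v : ℝ → State n m}

theorem continuous_snd_path (hu : Continuous u) (i : Fin m) : Continuous fun s => (u s).snd i :=
  (continuous_state_snd i).comp hu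

theorem continuous_reflectedPath (hu : Continuous u) : Continuous (reflectedPath u) := by
  have h := fun i => continuous_skorokhodRegulator (continuous_snd_path hu i)
  have h1 : Continuous fun t => (WithLp.toLp 2 fun i =>
      skorokhodRegulator (fun s => (u s).snd i) t : EuclideanSpace ℝ (Fin m)) :=
    (PiLp.continuous_toLp 2 _).comp (continuous_pi h)
  exact hu.add ((WithLp.prod_continuous_toLp 2 _ _).comp (continuous_const.prodMk h1))

theorem abs_snd_le_norm (z : State n m) (i : Fin m) : |z.snd i| ≤ ‖z‖ := by
  refine abs_le_of_sq_le_sq ?_ (norm_nonneg _)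
  rw [state_norm_sq_eq]
  have := Finset.single_le_sum (f := fun i => z.snd i ^ 2) (fun i _ => sq_nonneg _)
    (Finset.mem_univ i)
  dsimp only at this
  nlinarith [sq_nonneg ‖z.fst‖]

/-- Serves both comparisons: two paths at one time, and one path at two times. -/
theorem norm_sub_add_regulator_le {a b : State n m} {p q : Fin m → ℝ} {M : ℝ}
    (hab : ‖a - b‖ ≤ M) (hpq : ∀ i, |p i - q i| ≤ M) :
    ‖(a + WithLp.toLp 2 (0, WithLp.toLp 2 p)) - (b + WithLp.toLp 2 (0, WithLp.toLp 2 q))‖ ≤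
      (1 + m) * M := by
  have h := norm_toLp_zero_le (n := n) (WithLp.toLp 2 p - WithLp.toLp 2 q) hpq
  have heq : (WithLp.toLp 2 (0, WithLp.toLp 2 p - WithLp.toLp 2 q) : State n m) =
      WithLp.toLp 2 (0, WithLp.toLp 2 p) - WithLp.toLp 2 (0, WithLp.toLp 2 q) :=
    WithLp.ofLp_injective 2 (Prod.ext (sub_zero _).symm rfl)
  rw [add_sub_add_comm, ← heq]
  refine (norm_add_le _ _).trans ?_
  linarith

theorem reflectedPath_sub_le (hu : Continuous u) (hv : Continuous v) {t M : ℝ} (ht : 0 ≤ t)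
    (h : ∀ s ∈ Icc 0 t, ‖u s - v s‖ ≤ M) :
    ‖reflectedPath u t - reflectedPath v t‖ ≤ (1 + m) * M :=
  norm_sub_add_regulator_le (h t (right_mem_Icc.2 ht)) fun i =>
    skorokhodRegulator_sub_le (continuous_snd_path hu i) (continuous_snd_path hv i) ht
      fun s hs => (abs_snd_le_norm (u s - v s) i).trans (h s hs)

theorem lipschitzOnWith_reflectedPath (hu : Continuous u) {b : ℝ} {K : NNReal}
    (h : LipschitzOnWith K u (Icc 0 b)) :
    LipschitzOnWith ((1 + m) * K) (reflectedPath u) (Icc 0 b) := by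
  refine LipschitzOnWith.of_dist_le_mul fun s hs t ht => ?_
  push_cast
  rw [mul_assoc, dist_eq_norm]
  refine norm_sub_add_regulator_le (by rw [← dist_eq_norm]; exact h.dist_le_mul s hs t ht)
    fun i => ?_
  refine (lipschitzOnWith_skorokhodRegulator (continuous_snd_path hu i) ?_).dist_le_mul s hs t ht
  refine LipschitzOnWith.of_dist_le_mul fun r hr q hq => ?_
  refine le_trans ?_ (h.dist_le_mul r hr q hq)
  rw [Real.dist_eq, dist_eq_norm (u r)]
  exact abs_snd_le_norm (u r - u q) i

theorem ae_hasVelocity_reflectedPath (hu : Continuous u) {u' : ℝ → State n m}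
    (hd : ∀ t, 0 < t → HasVelocity u (u' t) t) :
    ∀ᵐ t : ℝ, 0 < t →
      HasVelocity (reflectedPath u) (projectVelocity (u' t) (reflectedPath u t)) t := by
  let e := (WithLp.prodContinuousLinearEquiv 2 ℝ (EuclideanSpace ℝ (Fin n))
    (EuclideanSpace ℝ (Fin m)))
  let e' := (PiLp.continuousLinearEquiv 2 ℝ fun _ : Fin m => ℝ).symm
  have hpair : ∀ t, 0 < t → HasVelocity (fun s => e (u s)) (e (u' t)) t := fun t ht =>
    (hd t ht).clm_comp e.toContinuousLinearMap
  have hsnd : ∀ i t, 0 < t → HasDerivAt (fun s => (u s).snd i) ((u' t).snd i) t := fun i t ht =>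
    (hpair t ht).clm_comp ((EuclideanSpace.proj i).comp (ContinuousLinearMap.snd ℝ _ _))
  have hfst : ∀ t, 0 < t → HasVelocity (fun s => (u s).fst) (u' t).fst t := fun t ht =>
    (hpair t ht).clm_comp (ContinuousLinearMap.fst ℝ _ _)
  have hae := fun i => ae_hasDerivAt_add_skorokhodRegulator (continuous_snd_path hu i) (hsnd i)
  filter_upwards [ae_all_iff.2 hae] with t ht h0
  have h1 : HasVelocity _ _ t := hasDerivAt_pi.2 fun i => ht i h0
  have h2 : HasVelocity _ _ t :=
    HasDerivAt.prodMk (hfst t h0) (h1.clm_comp e'.toContinuousLinearMap)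
  have h3 := h2.clm_comp e.symm.toContinuousLinearMap
  refine HasDerivAt.congr_of_eventuallyEq h3 (Eventually.of_forall fun s => ?_)
  refine WithLp.ofLp_injective 2 (Prod.ext ?_ rfl)
  change (u s).fst + 0 = (u s).fst
  exact add_zero _

/-- Solvability of the projected dynamics for a globally Lipschitz vector field. -/
theorem exists_projected_solution {A : State n m → State n m} {K : NNReal} (hA : LipschitzWith K A)
    {z₀ : State n m} (hz₀ : z₀ ∈ domain n m) :
    ∃ γ : ℝ → State n m, Continuous γ ∧ γ 0 = z₀ ∧ (∀ t, 0 ≤ t → γ t ∈ domain n m) ∧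
      (∀ b, 0 ≤ b → AbsolutelyContinuousOnInterval γ 0 b) ∧
      ∀ᵐ t : ℝ, 0 < t → HasVelocity γ (projectVelocity (A (γ t)) (γ t)) t := by
  have hzero : ∀ t, reflectedPath (fun _ => (0 : State n m)) t = 0 := by
    intro t
    have : (fun _ : Fin m => skorokhodRegulator (fun _ => 0) t) = 0 := by
      funext i
      simp [skorokhodRegulator]
    simp only [reflectedPath, WithLp.zero_snd, PiLp.zero_apply, this, WithLp.toLp_zero, zero_add]
    exact WithLp.toLp_zero 2
  obtain ⟨u, hu, hu0, hud, hlip⟩ := exists_hasVelocity_of_causal_lipschitz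
    (fun u t => A (reflectedPath u t)) (B := ‖A 0‖) (C := K * (1 + m)) (by positivity)
    (fun u hu => hA.continuous.comp (continuous_reflectedPath hu))
    (fun t => by rw [hzero])
    (fun u v hu hv t ht M hM => by
      rw [mul_assoc, ← dist_eq_norm]
      refine (hA.dist_le_mul _ _).trans ?_
      rw [dist_eq_norm]
      gcongr
      exact reflectedPath_sub_le hu hv ht hM) z₀
  refine ⟨reflectedPath u, continuous_reflectedPath hu, ?_, fun t ht i => ?_, fun b hb => ?_,
    ae_hasVelocity_reflectedPath hu hud⟩
  · have : (fun i : Fin m => skorokhodRegulator (fun s => (u s).snd i) 0) = 0 := by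
      funext i
      exact skorokhodRegulator_zero (by rw [hu0]; exact hz₀ i)
    rw [reflectedPath, this, hu0, WithLp.toLp_zero]
    exact add_zero z₀
  · rw [reflectedPath_snd]
    linarith [neg_le_skorokhodRegulator (continuous_snd_path hu i) (right_mem_Icc.2 ht)]
  · obtain ⟨M, hM⟩ := hlip b
    have := lipschitzOnWith_reflectedPath hu hM
    rw [← uIcc_of_le hb] at this
    exact this.absolutelyContinuousOnInterval

end ReflectedSolution

/-! ### Energy, uniqueness and asymptotics of Carathéodory solutions. -/

section CaratheodorySolutions

variable {E : Type*} [NormedAddCommGroup E] [InnerProductSpace ℝ E] {K : Set E} {X : E → E}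
  {T : EReal} {γ : ℝ → E}

theorem coe_lt_of_le {s t : ℝ} (hst : s ≤ t) (ht : (t : EReal) < T) : (s : EReal) < T :=
  (EReal.coe_le_coe_iff.2 hst).trans_lt ht

theorem IsCaratheodorySolution.absCont_sub (hγ : IsCaratheodorySolution K X T γ) {s t : ℝ}
    (hs : 0 ≤ s) (hst : s ≤ t) (ht : (t : EReal) < T) : AbsolutelyContinuousOnInterval γ s t := by
  refine (hγ.absCont t (hs.trans hst) ht).mono ?_
  rw [uIcc_of_le hst, uIcc_of_le (hs.trans hst)]
  exact Icc_subset_Icc_left hs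

theorem IsCaratheodorySolution.continuousOn (hγ : IsCaratheodorySolution K X T γ) {s t : ℝ}
    (hs : 0 ≤ s) (hst : s ≤ t) (ht : (t : EReal) < T) : ContinuousOn γ (Icc s t) := by
  simpa [uIcc_of_le hst] using (hγ.absCont_sub hs hst ht).continuousOn

/-- The energy estimate: if `⟪z - w, X z⟫ ≤ -W z` then `‖γ - w‖²` decreases at rate `2 W(γ)`. -/
theorem IsCaratheodorySolution.energy (hγ : IsCaratheodorySolution K X T γ) {W : E → ℝ}
    (hW : Continuous W) {w : E} (h : ∀ z ∈ K, inner ℝ (z - w) (X z) ≤ -W z) {s t : ℝ}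
    (hs : 0 ≤ s) (hst : s ≤ t) (ht : (t : EReal) < T) :
    ‖γ t - w‖ ^ 2 + 2 * ∫ r in s..t, W (γ r) ≤ ‖γ s - w‖ ^ 2 := by
  have hcd : ContDiff ℝ 1 fun z : E => ‖z - w‖ ^ 2 := (contDiff_id.sub contDiff_const).norm_sq ℝ
  have hac := hcd.locallyLipschitz.comp_absolutelyContinuousOnInterval (hγ.absCont_sub hs hst ht)
  have hint : IntervalIntegrable (fun r => -2 * W (γ r)) volume s t := by
    refine ContinuousOn.intervalIntegrable ?_
    rw [uIcc_of_le hst]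
    exact continuousOn_const.mul (hW.comp_continuousOn (hγ.continuousOn hs hst ht))
  have := hac.sub_le_integral hst hint (by
    filter_upwards [hγ.ode] with r hr hmem
    have h0 : 0 ≤ r := hs.trans hmem.1.le
    have hrT := coe_lt_of_le hmem.2.le ht
    refine ⟨_, ((hr h0 hrT).sub_const w).norm_sq, ?_⟩
    linarith [h _ (hγ.mem r h0 hrT)])
  rw [intervalIntegral.integral_const_mul] at this
  linarith

theorem IsCaratheodorySolution.norm_sub_le (hγ : IsCaratheodorySolution K X T γ) {w : E}
    (h : ∀ z ∈ K, inner ℝ (z - w) (X z) ≤ 0) {s t : ℝ}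
    (hs : 0 ≤ s) (hst : s ≤ t) (ht : (t : EReal) < T) : ‖γ t - w‖ ≤ ‖γ s - w‖ := by
  have := hγ.energy (W := fun _ => 0) continuous_const (by simpa using h) hs hst ht
  simp only [intervalIntegral.integral_zero, mul_zero, add_zero] at this
  exact le_of_sq_le_sq this (norm_nonneg _)

/-- Solutions are unique if the field is one-sided Lipschitz on compact subsets of the domain. -/
theorem IsCaratheodorySolution.eq_of_initial_eq {T' : EReal} {η : ℝ → E}
    (hX : ∀ B, IsCompact B → ∃ L : ℝ, ∀ z ∈ K ∩ B, ∀ w ∈ K ∩ B,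
      inner ℝ (z - w) (X z - X w) ≤ L * ‖z - w‖ ^ 2)
    (hγ : IsCaratheodorySolution K X T γ) (hη : IsCaratheodorySolution K X T' η)
    (h0 : γ 0 = η 0) {t : ℝ} (ht0 : 0 ≤ t) (ht : (t : EReal) < T) (ht' : (t : EReal) < T') :
    γ t = η t := by
  obtain ⟨L, hL⟩ := hX (γ '' Icc 0 t ∪ η '' Icc 0 t)
    ((isCompact_Icc.image_of_continuousOn (hγ.continuousOn le_rfl ht0 ht)).union
      (isCompact_Icc.image_of_continuousOn (hη.continuousOn le_rfl ht0 ht')))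
  have hcd : ContDiff ℝ 1 fun z : E => ‖z‖ ^ 2 := contDiff_id.norm_sq ℝ
  have hac := hcd.locallyLipschitz.comp_absolutelyContinuousOnInterval
    ((hγ.absCont t ht0 ht).sub (hη.absCont t ht0 ht'))
  -- Grönwall's integrating factor: `exp (-2 L s) ‖γ s - η s‖²` is nonincreasing and starts at `0`.
  have hexp : AbsolutelyContinuousOnInterval (fun s => Real.exp (-2 * L * s)) 0 t :=
    ContDiffOn.absolutelyContinuousOnInterval
      (by fun_prop : ContDiff ℝ 1 fun s => Real.exp (-2 * L * s)).contDiffOn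
  have hle := (hexp.mul hac).le_of_hasDerivAt_nonpos ht0 (by
    filter_upwards [hγ.ode, hη.ode] with s hs hs' hmem
    have hsT := coe_lt_of_le hmem.2.le ht
    have hsT' := coe_lt_of_le hmem.2.le ht'
    have hd := ((hs hmem.1.le hsT).sub (hs' hmem.1.le hsT')).norm_sq
    have he : HasDerivAt (fun s => Real.exp (-2 * L * s))
        (Real.exp (-2 * L * s) * (-2 * L * 1)) s :=
      ((hasDerivAt_id s).const_mul (-2 * L)).exp
    refine ⟨_, he.mul hd, ?_⟩
    have hmem' : s ∈ Icc 0 t := ⟨hmem.1.le, hmem.2.le⟩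
    have := hL (γ s) ⟨hγ.mem s hmem.1.le hsT, Or.inl (mem_image_of_mem _ hmem')⟩
      (η s) ⟨hη.mem s hmem.1.le hsT', Or.inr (mem_image_of_mem _ hmem')⟩
    have hpos := Real.exp_pos (-2 * L * s)
    simp only [Pi.sub_apply]
    nlinarith)
  simp only [Pi.mul_apply, Pi.sub_apply, h0, sub_self, norm_zero] at hle
  have hpos := Real.exp_pos (-2 * L * t)
  have : ‖γ t - η t‖ ^ 2 ≤ 0 := by
    by_contra! hlt
    nlinarith [mul_pos hpos hlt]
  rw [← sub_eq_zero, ← norm_eq_zero]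
  exact pow_eq_zero_iff two_ne_zero |>.1 (le_antisymm this (sq_nonneg _))

/-- A global solution along which the field is bounded is Lipschitz. -/
theorem IsCaratheodorySolution.lipschitzWith_max_zero (hγ : IsCaratheodorySolution K X ⊤ γ)
    {M : NNReal} (hM : ∀ t, 0 ≤ t → ‖X (γ t)‖ ≤ M) : LipschitzWith M fun t => γ (max t 0) := by
  have key : ∀ s t, 0 ≤ s → s ≤ t → dist (γ s) (γ t) ≤ M * dist s t := by
    intro s t hs hst
    rw [dist_comm, dist_eq_norm, dist_comm, Real.dist_eq, abs_of_nonneg (sub_nonneg.2 hst)]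
    refine (hγ.absCont_sub hs hst (EReal.coe_lt_top t)).norm_sub_le_of_hasDerivAt hst ?_
    filter_upwards [hγ.ode] with r hr hmem
    have h0 : 0 ≤ r := hs.trans hmem.1.le
    exact ⟨_, hr h0 (EReal.coe_lt_top r), hM r h0⟩
  refine LipschitzWith.of_dist_le_mul fun s t => ?_
  have hmax : dist (max s 0) (max t 0) ≤ dist s t := by
    simpa [Real.dist_eq] using abs_max_sub_max_le_abs s t 0
  refine le_trans ?_ (mul_le_mul_of_nonneg_left hmax M.2)
  rcases le_total (max s 0) (max t 0) with h | h
  · exact key _ _ (le_max_right _ _) h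
  · rw [dist_comm, dist_comm (max s 0)]
    exact key _ _ (le_max_right _ _) h

/-- If the energy estimate holds with a rate `W ≥ 0`, then `W` tends to `0` along every global
solution along which it is uniformly continuous. -/
theorem IsCaratheodorySolution.tendsto_rate_zero (hγ : IsCaratheodorySolution K X ⊤ γ)
    {W : E → ℝ} (hW : Continuous W) (hW0 : ∀ z ∈ K, 0 ≤ W z) {w : E}
    (h : ∀ z ∈ K, inner ℝ (z - w) (X z) ≤ -W z)
    (huc : UniformContinuous fun t => W (γ (max t 0))) :
    Tendsto (fun t => W (γ (max t 0))) atTop (𝓝 0) := by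
  have hnonneg : ∀ t, 0 ≤ W (γ (max t 0)) := fun t =>
    hW0 _ (hγ.mem _ (le_max_right _ _) (EReal.coe_lt_top _))
  have hii : ∀ a b, IntervalIntegrable (fun t => W (γ (max t 0))) volume a b :=
    fun a b => huc.continuous.intervalIntegrable a b
  have hmono : Monotone fun t => ∫ s in (0 : ℝ)..t, W (γ (max s 0)) := by
    intro s t hst
    dsimp only
    rw [← sub_nonneg, intervalIntegral.integral_interval_sub_left (hii _ _) (hii _ _)]
    exact intervalIntegral.integral_nonneg hst fun r _ => hnonneg r
  have hbdd : BddAbove (range fun t => ∫ s in (0 : ℝ)..t, W (γ (max s 0))) := by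
    refine ⟨‖γ 0 - w‖ ^ 2, ?_⟩
    rintro _ ⟨t, rfl⟩
    refine (hmono (le_max_left t 0)).trans ?_
    have hcongr : ∫ s in (0 : ℝ)..max t 0, W (γ (max s 0)) = ∫ s in (0 : ℝ)..max t 0, W (γ s) := by
      refine intervalIntegral.integral_congr fun s hs => ?_
      rw [uIcc_of_le (le_max_right _ _)] at hs
      simp only [max_eq_left hs.1]
    have hen := hγ.energy hW h le_rfl (le_max_right t 0) (EReal.coe_lt_top _)
    have hnn := intervalIntegral.integral_nonneg (μ := volume) (le_max_right t 0) fun r _ =>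
      hnonneg r
    dsimp only
    rw [hcongr] at hnn ⊢
    nlinarith [sq_nonneg ‖γ (max t 0) - w‖]
  exact huc.tendsto_zero_of_tendsto_integral (tendsto_atTop_ciSup hmono hbdd)

/-- If a linear functional `L` converges along a global solution, then its velocity `L ∘ X`
tends to `0`, provided that it is uniformly continuous in time. -/
theorem IsCaratheodorySolution.tendsto_velocity_zero (hγ : IsCaratheodorySolution K X ⊤ γ)
    (L : E →L[ℝ] ℝ) (huc : UniformContinuous fun t => L (X (γ (max t 0)))) {c : ℝ}
    (hc : Tendsto (fun t => L (γ t)) atTop (𝓝 c)) :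
    Tendsto (fun t => L (X (γ (max t 0)))) atTop (𝓝 0) := by
  refine huc.tendsto_zero_of_tendsto_integral (a := c - L (γ 0))
    ((hc.sub_const _).congr' ?_)
  filter_upwards [eventually_ge_atTop 0] with t ht
  have hac := L.lipschitz.locallyLipschitz.comp_absolutelyContinuousOnInterval
    (hγ.absCont t ht (EReal.coe_lt_top t))
  refine hac.sub_eq_integral ht (huc.continuous.intervalIntegrable 0 t) ?_
  filter_upwards [hγ.ode] with s hs hmem
  rw [max_eq_left hmem.1.le]
  exact HasVelocity.clm_comp (hs hmem.1.le (EReal.coe_lt_top s)) L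

theorem _root_.UniformContinuous.comp_of_mem_compact {α β δ : Type*} [UniformSpace α]
    [UniformSpace β] [UniformSpace δ] {B : Set β} (hB : IsCompact B) {η : α → β}
    (hη : UniformContinuous η) (hmem : ∀ t, η t ∈ B) {ψ : β → δ} (hψ : Continuous ψ) :
    UniformContinuous fun t => ψ (η t) :=
  uniformContinuousOn_univ.1 ((hB.uniformContinuousOn_of_continuous hψ.continuousOn).comp
    (uniformContinuousOn_univ.2 hη) fun t _ => hmem t)

end CaratheodorySolutions

/-! ### Limits at cluster points. -/

section ClusterPoints

theorem _root_.MapClusterPt.eq_of_tendsto_comp {α E F : Type*} [TopologicalSpace E]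
    [TopologicalSpace F] [T2Space F] {l : Filter α} {γ : α → E} {z : E} (hz : MapClusterPt z l γ) {ψ : E → F}
    (hψ : Continuous ψ) {c : F} (h : Tendsto (fun t => ψ (γ t)) l (𝓝 c)) : ψ z = c := by
  have h1 : MapClusterPt (ψ z) l (ψ ∘ γ) := hz.continuousAt_comp hψ.continuousAt
  have h2 : ClusterPt (ψ z) (𝓝 c) := h1.clusterPt.mono h
  exact eq_of_nhds_neBot h2

end ClusterPoints

/-! ### Existence and convergence for the primal-dual dynamics. -/

section PrimalDualSolutions

variable {n m : ℕ} {f : EuclideanSpace ℝ (Fin n) → ℝ}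
  {g : EuclideanSpace ℝ (Fin n) → EuclideanSpace ℝ (Fin m)}

/-- The duality gap of `z` relative to the saddle point `w`. -/
noncomputable def relativeGap (f : EuclideanSpace ℝ (Fin n) → ℝ)
    (g : EuclideanSpace ℝ (Fin n) → EuclideanSpace ℝ (Fin m)) (w z : State n m) : ℝ :=
  lagrangian f g w.fst z.snd - lagrangian f g z.fst w.snd

theorem continuous_relativeGap (hf : Continuous f) (hg : Continuous g) (w : State n m) :
    Continuous (relativeGap f g w) := by
  have h := continuous_lagrangian hf hg
  have h1 : Continuous fun z : State n m => (w.fst, z.snd) := by fun_prop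
  have h2 : Continuous fun z : State n m => (z.fst, w.snd) := by fun_prop
  exact (h.comp h1).sub (h.comp h2)

/-- Keeps only the part of the gap that depends on `x`; when the gap vanishes, `z.fst` maximizes
`L(·, w.snd)`. -/
theorem relativeGap_ge {w z : State n m} (hw : w ∈ saddlePoints f g) (hz : z ∈ domain n m) :
    lagrangian f g w.fst w.snd - lagrangian f g z.fst w.snd ≤ relativeGap f g w z :=
  sub_le_sub_right (hw.2.2 z.snd hz) _

theorem relativeGap_nonneg {w z : State n m} (hw : w ∈ saddlePoints f g) (hz : z ∈ domain n m) :
    0 ≤ relativeGap f g w z :=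
  (sub_nonneg.2 (hw.2.1 z.fst)).trans (relativeGap_ge hw hz)

theorem inner_sub_primalDualField_le (hf : ContDiff ℝ 1 f) (hg : ContDiff ℝ 1 g)
    (hf_concave : ConcaveOn ℝ univ f) (hg_convex : ∀ i, ConvexOn ℝ univ (fun x => g x i))
    {w z : State n m} (hw : w ∈ domain n m) (hz : z ∈ domain n m) :
    inner ℝ (z - w) (primalDualField f g z) ≤ -relativeGap f g w z := by
  rw [primalDualField_eq, relativeGap, neg_sub]
  exact (inner_sub_projectVelocity_le hz hw _).trans
    (inner_sub_saddleField_le hf hg hf_concave hg_convex hz w)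

theorem inner_sub_primalDualField_nonpos (hf : ContDiff ℝ 1 f) (hg : ContDiff ℝ 1 g)
    (hf_concave : ConcaveOn ℝ univ f) (hg_convex : ∀ i, ConvexOn ℝ univ (fun x => g x i))
    {w z : State n m} (hw : w ∈ saddlePoints f g) (hz : z ∈ domain n m) :
    inner ℝ (z - w) (primalDualField f g z) ≤ 0 :=
  (inner_sub_primalDualField_le hf hg hf_concave hg_convex hw.1 hz).trans
    (neg_nonpos.2 (relativeGap_nonneg hw hz))

/-- The field itself jumps where multipliers vanish. Applying `inner_sub_projectVelocity_le` at `z`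
and at `w` bounds the pairing by that of the unprojected fields. -/
theorem primalDualField_oneSided_lipschitz (hloc : LocallyLipschitz (saddleField f g))
    (B : Set (State n m)) (hB : IsCompact B) :
    ∃ L : ℝ, ∀ z ∈ domain n m ∩ B, ∀ w ∈ domain n m ∩ B,
      inner ℝ (z - w) (primalDualField f g z - primalDualField f g w) ≤ L * ‖z - w‖ ^ 2 := by
  have hlocB : LocallyLipschitzOn B (saddleField f g) := hloc.locallyLipschitzOn
  obtain ⟨L, hL⟩ := hlocB.exists_lipschitzOnWith_of_compact hB
  refine ⟨L, fun z hz w hw => ?_⟩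
  have h1 := inner_sub_projectVelocity_le hz.1 hw.1 (saddleField f g z)
  have h2 := inner_sub_projectVelocity_le hw.1 hz.1 (saddleField f g w)
  rw [← neg_sub z w, inner_neg_left, inner_neg_left, neg_le_neg_iff] at h2
  have h3 : inner ℝ (z - w) (saddleField f g z - saddleField f g w) ≤ L * ‖z - w‖ ^ 2 := by
    refine (real_inner_le_norm _ _).trans ?_
    have := hL.dist_le_mul z hz.2 w hw.2
    rw [dist_eq_norm, dist_eq_norm] at this
    nlinarith [norm_nonneg (z - w)]
  rw [inner_sub_right] at h3 ⊢
  rw [primalDualField_eq, primalDualField_eq]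
  linarith

/-- From every point of the domain there starts a solution for all times. -/
theorem exists_primalDual_solution (hf : ContDiff ℝ 1 f) (hg : ContDiff ℝ 1 g)
    (hf_concave : ConcaveOn ℝ univ f) (hg_convex : ∀ i, ConvexOn ℝ univ (fun x => g x i))
    (hloc : LocallyLipschitz (saddleField f g)) {w z₀ : State n m} (hw : w ∈ saddlePoints f g)
    (hz₀ : z₀ ∈ domain n m) :
    ∃ γ, IsCaratheodorySolution (domain n m) (primalDualField f g) ⊤ γ ∧ γ 0 = z₀ := by
  -- The margin `1` places `z₀` strictly inside the ball on which the globally Lipschitz extension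
  -- agrees with the true field.
  set R := ‖z₀ - w‖ + 1 with hR
  have hlocB : LocallyLipschitzOn (Metric.closedBall w R) (saddleField f g) :=
    hloc.locallyLipschitzOn
  obtain ⟨L, hL⟩ := hlocB.exists_lipschitzOnWith_of_compact (isCompact_closedBall w R)
  obtain ⟨A, hA, hAeq⟩ := hL.extend_finite_dimension
  obtain ⟨γ, hcont, h0, hdom, hac, hae⟩ := exists_projected_solution hA hz₀
  have hsol : ∀ T : EReal, 0 < T →
      (∀ t : ℝ, 0 ≤ t → (t : EReal) < T → γ t ∈ Metric.closedBall w R) →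
      IsCaratheodorySolution (domain n m) (primalDualField f g) T γ := by
    intro T hT hball
    refine ⟨hT, fun t ht _ => hdom t ht, fun b hb _ => hac b hb, ?_⟩
    filter_upwards [hae, Measure.ae_ne volume (0 : ℝ)] with t ht hne ht0 htT
    have := ht (lt_of_le_of_ne ht0 (Ne.symm hne))
    rwa [← hAeq (hball t ht0 htT)] at this
  have hball : ∀ t, 0 ≤ t → ‖γ t - w‖ < R := by
    by_contra! hcon
    -- Up to the first exit time the curve solves the true dynamics, so its distance to `w` stays at
    -- most `R - 1`, also in the limit: a contradiction.
    set F : Set ℝ := {t | 0 ≤ t ∧ R ≤ ‖γ t - w‖} with hF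
    have hF_closed : IsClosed F :=
      (isClosed_le continuous_const continuous_id).inter
        (isClosed_le continuous_const (hcont.sub continuous_const).norm)
    have hF_bdd : BddBelow F := ⟨0, fun t ht => ht.1⟩
    have hmem : sInf F ∈ F := hF_closed.csInf_mem hcon hF_bdd
    set t₁ := sInf F
    have hpos : 0 < t₁ := by
      refine lt_of_le_of_ne hmem.1 fun h => ?_
      have := hmem.2
      rw [← h, h0] at this
      linarith
    have hlt : ∀ t, 0 ≤ t → t < t₁ → ‖γ t - w‖ < R := fun t ht htt => by
      by_contra! hge
      exact absurd (csInf_le hF_bdd ⟨ht, hge⟩) (not_le.2 htt)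
    have hs := hsol t₁ (EReal.coe_pos.2 hpos) fun t ht htt => by
      rw [mem_closedBall_iff_norm]
      exact (hlt t ht (EReal.coe_lt_coe_iff.1 htt)).le
    have hle : ∀ t, 0 ≤ t → t < t₁ → ‖γ t - w‖ ≤ ‖γ 0 - w‖ := fun t ht htt =>
      hs.norm_sub_le (fun z hz => inner_sub_primalDualField_nonpos hf hg hf_concave hg_convex hw hz)
        le_rfl ht (EReal.coe_lt_coe_iff.2 htt)
    have hlim : Tendsto (fun t => ‖γ t - w‖) (𝓝[<] t₁) (𝓝 ‖γ t₁ - w‖) :=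
      ((hcont.sub continuous_const).norm.tendsto t₁).mono_left nhdsWithin_le_nhds
    have := le_of_tendsto hlim (b := ‖γ 0 - w‖) (by
      filter_upwards [self_mem_nhdsWithin, mem_nhdsWithin_of_mem_nhds (lt_mem_nhds hpos)]
        with t ht ht' using hle t ht'.le ht)
    rw [h0] at this
    linarith [hmem.2]
  exact ⟨γ, hsol ⊤ EReal.zero_lt_top fun t ht _ => mem_closedBall_iff_norm.2 (hball t ht).le, h0⟩

/-- Every global solution converges to a saddle point. -/
theorem exists_tendsto_saddlePoint (hf : ContDiff ℝ 1 f) (hg : ContDiff ℝ 1 g)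
    (hf_concave : StrictConcaveOn ℝ univ f) (hg_convex : ∀ i, ConvexOn ℝ univ (fun x => g x i))
    (hloc : LocallyLipschitz (saddleField f g)) {w : State n m} (hw : w ∈ saddlePoints f g)
    {γ : ℝ → State n m} (hγ : IsCaratheodorySolution (domain n m) (primalDualField f g) ⊤ γ) :
    ∃ z ∈ saddlePoints f g, Tendsto γ atTop (𝓝 z) := by
  set B := Metric.closedBall w ‖γ 0 - w‖ with hB_def
  have hB : IsCompact B := isCompact_closedBall _ _
  have hcc := hf_concave.concaveOn
  have hnonpos : ∀ v ∈ saddlePoints f g, ∀ z ∈ domain n m,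
      inner ℝ (z - v) (primalDualField f g z) ≤ 0 := fun v hv z hz =>
    inner_sub_primalDualField_nonpos hf hg hcc hg_convex hv hz
  have hγB : ∀ t, 0 ≤ t → γ t ∈ B := fun t ht => mem_closedBall_iff_norm.2
    (hγ.norm_sub_le (hnonpos w hw) le_rfl ht (EReal.coe_lt_top t))
  have hγdom : ∀ t, 0 ≤ t → γ t ∈ domain n m := fun t ht => hγ.mem t ht (EReal.coe_lt_top t)
  obtain ⟨M, hM⟩ := hB.exists_bound_of_continuousOn hloc.continuous.continuousOn
  -- Frozen at `γ 0` for negative times, so that uniform continuity and Barbalat's lemma apply on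
  -- all of `ℝ`.
  set η : ℝ → State n m := fun t => γ (max t 0) with hη
  have hηB : ∀ t, η t ∈ B := fun t => hγB _ (le_max_right _ _)
  have hηdom : ∀ t, η t ∈ domain n m := fun t => hγdom _ (le_max_right _ _)
  have hηγ : ∀ t, 0 ≤ t → η t = γ t := fun t ht => by simp [hη, ht]
  have hbound : ∀ t, 0 ≤ t → ‖primalDualField f g (γ t)‖ ≤ M.toNNReal := fun t ht => by
    rw [primalDualField_eq]
    exact (norm_projectVelocity_le _ _).trans ((hM _ (hγB t ht)).trans (Real.le_coe_toNNReal M))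
  have hlip : LipschitzWith M.toNNReal η := hγ.lipschitzWith_max_zero hbound
  have huc : ∀ ψ : State n m → ℝ, Continuous ψ → UniformContinuous fun t => ψ (η t) :=
    fun ψ hψ => hlip.uniformContinuous.comp_of_mem_compact hB hηB hψ
  have hgap_cont := continuous_relativeGap (m := m) hf.continuous hg.continuous w
  have hgap : Tendsto (fun t => relativeGap f g w (η t)) atTop (𝓝 0) :=
    hγ.tendsto_rate_zero hgap_cont (fun z hz => relativeGap_nonneg hw hz)
      (fun z hz => inner_sub_primalDualField_le hf hg hcc hg_convex hw.1 hz) (huc _ hgap_cont)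
  have hx : Tendsto (fun t => (η t).fst) atTop (𝓝 w.fst) := by
    have hL : Continuous fun x => lagrangian f g w.fst w.snd - lagrangian f g x w.snd := by
      have := continuous_lagrangian hf.continuous hg.continuous
      exact continuous_const.sub (this.comp (continuous_id.prodMk continuous_const))
    have hsq : Tendsto (fun t => lagrangian f g w.fst w.snd - lagrangian f g (η t).fst w.snd)
        atTop (𝓝 0) :=
      squeeze_zero (fun t => sub_nonneg.2 (hw.2.1 _)) (fun t => relativeGap_ge hw (hηdom t)) hgap
    refine (hB.image continuous_state_fst).tendsto_nhds_of_unique_mapClusterPt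
      (Eventually.of_forall fun t => mem_image_of_mem _ (hηB t)) fun x _ hxc => ?_
    have hzero := hxc.eq_of_tendsto_comp hL hsq
    refine (strictConcaveOn_lagrangian hf_concave hg_convex hw.1).eq_of_isMaxOn
      (fun y _ => ?_) (fun y _ => hw.2.1 y) (mem_univ _) (mem_univ _)
    exact (hw.2.1 y).trans (sub_eq_zero.1 hzero).le
  -- Second use of Barbalat's lemma, tested against each `v`: the primal velocity is not projected,
  -- hence uniformly continuous along the curve.
  have hvel : ∀ v : EuclideanSpace ℝ (Fin n),
      Tendsto (fun t => inner ℝ v (saddleField f g (η t)).fst) atTop (𝓝 0) := by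
    intro v
    have hψ : Continuous fun z : State n m => inner ℝ v (saddleField f g z).fst :=
      continuous_const.inner (continuous_state_fst.comp hloc.continuous)
    let L : State n m →L[ℝ] ℝ := (innerSL ℝ v).comp ((ContinuousLinearMap.fst ℝ _ _).comp
      (WithLp.prodContinuousLinearEquiv 2 ℝ (EuclideanSpace ℝ (Fin n))
        (EuclideanSpace ℝ (Fin m))).toContinuousLinearMap)
    refine hγ.tendsto_velocity_zero L (huc _ hψ) (c := inner ℝ v w.fst) ?_
    refine (((continuous_const.inner continuous_id).tendsto w.fst).comp hx).congr' ?_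
    filter_upwards [eventually_ge_atTop 0] with t ht
    rw [← hηγ t ht]
    rfl
  obtain ⟨z, hzB, hz⟩ := hB.exists_mapClusterPt (f := atTop) (u := η)
    (tendsto_principal.2 (Eventually.of_forall hηB))
  have hzdom : z ∈ domain n m := isClosed_domain.mem_of_mapClusterPt hz
    (Eventually.of_forall hηdom)
  have hzfst : z.fst = w.fst := hz.eq_of_tendsto_comp continuous_state_fst hx
  have hzgap : lagrangian f g w.fst z.snd = lagrangian f g z.fst w.snd :=
    sub_eq_zero.1 (hz.eq_of_tendsto_comp hgap_cont hgap)
  have hzvel : (saddleField f g z).fst = 0 := ext_inner_left ℝ fun v => by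
    rw [inner_zero_right]
    exact hz.eq_of_tendsto_comp
      (continuous_const.inner (continuous_state_fst.comp hloc.continuous)) (hvel v)
  -- Stationarity gives maximality in `x`. Since `z.fst = w.fst`, the zero gap gives `z.snd` the
  -- same value of `L` as the minimizing `w.snd`.
  have hzS : z ∈ saddlePoints f g := by
    refine ⟨hzdom, fun y => ?_, fun mu hmu => ?_⟩
    · have := lagrangian_le_add_inner hf hg hcc hg_convex hzdom y
      rwa [hzvel, inner_zero_left, add_zero] at this
    · rw [hzfst] at hzgap ⊢
      rw [hzgap]
      exact hw.2.2 mu hmu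
  -- The distance to the saddle point `z` never increases, so one visit to a ball about it traps the
  -- curve.
  refine ⟨z, hzS, Metric.tendsto_atTop.2 fun ε hε => ?_⟩
  obtain ⟨N, hN0, hN⟩ := Filter.frequently_atTop.1
    (hz.frequently (Metric.ball_mem_nhds z hε)) 0
  refine ⟨N, fun t ht => ?_⟩
  rw [hηγ N hN0, dist_eq_norm] at hN
  rw [dist_eq_norm]
  exact (hγ.norm_sub_le (hnonpos z hzS) hN0 ht (EReal.coe_lt_top t)).trans_lt hN

end PrimalDualSolutions

end PrimalDual

/-! ### Assembly of the theorem. -/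

theorem mainTheorem1 (n m : ℕ)
    (f : EuclideanSpace ℝ (Fin n) → ℝ)
    (g : EuclideanSpace ℝ (Fin n) → EuclideanSpace ℝ (Fin m))
    (hf : ContDiff ℝ 1 f) (hg : ContDiff ℝ 1 g)
    (hf_concave : StrictConcaveOn ℝ Set.univ f)
    (hg_convex : ∀ i, ConvexOn ℝ Set.univ (fun x => g x i))
    (hf_lip : LocallyLipschitz (gradient f))
    (hg_lip : ∀ i, LocallyLipschitz (gradient (fun x => g x i)))
    (h_slater : ∃ x, ∀ i, g x i < 0)
    (h_opt : ∃ x, PrimalDual.IsPrimalOptimizer f g x) :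
    PrimalDual.primalDualOptimizers f g = PrimalDual.saddlePoints f g ∧
    PrimalDual.IsGloballyAsymptoticallyStableOn (PrimalDual.domain n m)
      (PrimalDual.primalDualField f g) (PrimalDual.primalDualOptimizers f g) ∧
    ∀ γ : ℝ → PrimalDual.State n m,
      PrimalDual.IsCaratheodorySolution (PrimalDual.domain n m)
        (PrimalDual.primalDualField f g) ⊤ γ →
      ∃ z ∈ PrimalDual.primalDualOptimizers f g, Filter.Tendsto γ Filter.atTop (nhds z) := by
  have hcc := hf_concave.concaveOn
  have hS := PrimalDual.primalDualOptimizers_eq_saddlePoints hcc hg_convex h_slater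
  obtain ⟨w, hw⟩ := PrimalDual.saddlePoints_nonempty hcc hg_convex h_slater h_opt
  have hloc := PrimalDual.locallyLipschitz_saddleField hg hf_lip hg_lip
  have hconv := fun γ hγ =>
    PrimalDual.exists_tendsto_saddlePoint hf hg hf_concave hg_convex hloc hw (γ := γ) hγ
  rw [hS]
  refine ⟨rfl, ⟨fun z hz => hz.1, fun z hz => ?_, fun T γ hγ => ?_, fun ε hε => ?_,
    fun γ hγ ε hε => ?_⟩, hconv⟩
  · exact PrimalDual.exists_primalDual_solution hf hg hcc hg_convex hloc hw hz
  · obtain ⟨γ', hγ', h0⟩ := PrimalDual.exists_primalDual_solution hf hg hcc hg_convex hloc hw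
      (hγ.mem 0 le_rfl hγ.pos)
    -- By uniqueness, the global solution from the same initial point continues `γ`.
    exact ⟨γ', hγ', fun t ht htT => hγ'.eq_of_initial_eq
      (PrimalDual.primalDualField_oneSided_lipschitz hloc) hγ h0 ht (EReal.coe_lt_top t) htT⟩
  · refine ⟨ε, hε, fun T γ hγ h0 t ht htT => ?_⟩
    obtain ⟨z, hz, hlt⟩ := Metric.mem_thickening_iff.1 h0
    refine Metric.mem_thickening_iff.2 ⟨z, hz, ?_⟩
    rw [dist_eq_norm] at hlt ⊢
    exact (hγ.norm_sub_le (fun y hy => PrimalDual.inner_sub_primalDualField_nonpos hf hg hcc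
      hg_convex hz hy) le_rfl ht htT).trans_lt hlt
  · obtain ⟨z, hz, hlim⟩ := hconv γ hγ
    filter_upwards [Metric.tendsto_nhds.1 hlim ε hε] with t ht
    exact Metric.mem_thickening_iff.2 ⟨z, hz, ht⟩
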